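/- Let $\mathfrak g$ be a finite-dimensional complex Lie algebra. For $x\in\mathfrak g^*$ let $\mathcal A_x(u,v)=\langle x,[u,v]\rangle$, a skew-symmetric bilinear form on $\mathfrak g$. By the Jordan--Kronecker theorem a pair of skew-symmetric forms $(A,B)$ on a finite-dimensional complex vector space can be brought simultaneously to a block-diagonal form whose blocks are Jordan $2n\times 2n$ blocks ($n\ge 1$) with eigenvalues in $\mathbb C\cup\{\infty\}$ and Kronecker $(2k-1)\times(2k-1)$ blocks ($k\ge 1$; for $k=1$ both forms are the zero $1\times1$ matrix, the *trivial* block). A Jordan tuple $(2n_1,\dots,2n_s)$ consists of the sizes of all Jordan blocks with one and the same eigenvalue, so that $s\geq 1$, $n_1\ge\dots\ge n_s\ge1$; it has *multiple maxima* if $s\ge2$ and $n_1=n_2$. The Jordan--Kronecker (JK) invariants of $\mathfrak g$ are the multiset of Jordan tuples (one for each distinct eigenvalue) together with the multiset of Kronecker sizes $2k-1$ of the pair $(\mathcal A_x,\mathcal A_a)$, for $(x,a)$ in a non-empty Zariski open subset of $\mathfrak g^*\times\mathfrak g^*$ on which they are constant. **Theorem.** Let $(2n_{t1},\dots,2n_{ts_t})$,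 $t=1,\dots,p$ ($p\ge0$), be a finite collection of Jordan tuples, repetitions allowed. 1. If at most one of these tuples (counted with repetition) has multiple maxima, then there is a finite-dimensional complex Lie algebra whose JK invariants are exactly these $p$ Jordan tuples and one trivial $1\times1$ Kronecker block. 2. For every $r\ge2$ and with no condition on the tuples, there is a finite-dimensional complex Lie algebra whose JK invariants are exactly these $p$ Jordan tuples and $r$ trivial $1\times1$ Kronecker blocks. Moreover, it may be taken to be the Heisenberg-type Lie algebra with basis $h_1,\dots,h_r$, $e^i_{tj}$, $f^i_{tj}$ ($1\le t\le p$, $1\le i\le s_t$, $1\le j\le n_{ti}$), in which $[e^i_{tj},f^i_{tk}]=e^i_{t,j-k}$ for $j>k$, $[e^i_{tj},f^i_{tj}]=h_1+t\,h_2$, and all other brackets of basis elements not determined by these through skew-symmetry are $0$. -/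

import Mathlib

open scoped Matrix

noncomputable section

namespace JordanKronecker

/-- The skew-symmetric matrix with off-diagonal parts `M` and `-Mᵀ`. -/
def skewBlock {α β : Type} (M : Matrix α β ℂ) : Matrix (α ⊕ β) (α ⊕ β) ℂ :=
  Matrix.fromBlocks 0 M (-Mᵀ) 0

/-- The `n × n` Jordan matrix: `μ` on the diagonal and `1` just above it. -/
def jordanMatrix (n : ℕ) (μ : ℂ) : Matrix (Fin n) (Fin n) ℂ :=
  Matrix.of fun i j => if i = j then μ else if i.val + 1 = j.val then 1 else 0

/-- The matrix of the first form on a Jordan `2n × 2n` block with eigenvalue `μ ∈ ℂ ∪ {∞}`. -/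
def jordanA (n : ℕ) : OnePoint ℂ → Matrix (Fin n ⊕ Fin n) (Fin n ⊕ Fin n) ℂ
  | OnePoint.some μ => skewBlock (jordanMatrix n μ)
  | OnePoint.infty => skewBlock 1

/-- The matrix of the second form on a Jordan `2n × 2n` block with eigenvalue `μ ∈ ℂ ∪ {∞}`. -/
def jordanB (n : ℕ) : OnePoint ℂ → Matrix (Fin n ⊕ Fin n) (Fin n ⊕ Fin n) ℂ
  | OnePoint.some _ => skewBlock 1
  | OnePoint.infty => skewBlock (jordanMatrix n 0)

/-- The matrix of the first form on a Kronecker `(2m+1) × (2m+1)` block. -/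
def kroneckerA (m : ℕ) : Matrix (Fin m ⊕ Fin (m + 1)) (Fin m ⊕ Fin (m + 1)) ℂ :=
  skewBlock (Matrix.of fun i j => if i.val = j.val then 1 else 0)

/-- The matrix of the second form on a Kronecker `(2m+1) × (2m+1)` block. -/
def kroneckerB (m : ℕ) : Matrix (Fin m ⊕ Fin (m + 1)) (Fin m ⊕ Fin (m + 1)) ℂ :=
  skewBlock (Matrix.of fun i j => if i.val + 1 = j.val then 1 else 0)

/-- An algebraic type. `jordan` is the multiset of Jordan tuples `(2n₁, …, 2nₛ)`, each tuple
being the unordered (equivalently: sorted in descending order) collection of the sizes of its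
blocks. `kronecker` is the multiset of the Kronecker sizes `2k - 1`. -/
@[ext]
structure AlgType : Type where
  jordan : Multiset (Multiset ℕ)
  kronecker : Multiset ℕ

open Classical in
/-- The type of a collection of Jordan `2nᵢ × 2nᵢ` blocks with eigenvalues `μᵢ` and Kronecker
`(2mⱼ+1) × (2mⱼ+1)` blocks: the sizes of the Jordan blocks are grouped by eigenvalue, one tuple
for each distinct eigenvalue, and the values of the eigenvalues are forgotten. -/
def algTypeOfBlocks {I J : Type} [Fintype I] [Fintype J]
    (μ : I → OnePoint ℂ) (n : I → ℕ) (m : J → ℕ) : AlgType where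
  jordan := (Finset.univ.image μ).val.map fun ν =>
    (Finset.univ.filter fun i => μ i = ν).val.map fun i => 2 * n i
  kronecker := Finset.univ.val.map fun j => 2 * m j + 1

/-- The pencil `A + λ B` on `V` has algebraic type `T`: in some basis of `V` both forms are
block-diagonal with canonical Jordan and Kronecker blocks, and `T` is the type of this
collection of blocks. -/
def HasAlgType {V : Type*} [AddCommGroup V] [Module ℂ V]
    (A B : LinearMap.BilinForm ℂ V) (T : AlgType) : Prop :=
  ∃ (I J : Type) (_ : Fintype I) (_ : DecidableEq I) (_ : Fintype J) (_ : DecidableEq J)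
    (μ : I → OnePoint ℂ) (n : I → ℕ) (m : J → ℕ)
    (b : Module.Basis ((Σ i, Fin (n i) ⊕ Fin (n i)) ⊕ (Σ j, Fin (m j) ⊕ Fin (m j + 1))) ℂ V),
    (∀ i, 0 < n i) ∧
    (∀ u v, A (b u) (b v) =
      Matrix.fromBlocks (Matrix.blockDiagonal' fun i => jordanA (n i) (μ i)) 0
        0 (Matrix.blockDiagonal' fun j => kroneckerA (m j)) u v) ∧
    (∀ u v, B (b u) (b v) =
      Matrix.fromBlocks (Matrix.blockDiagonal' fun i => jordanB (n i) (μ i)) 0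
        0 (Matrix.blockDiagonal' fun j => kroneckerB (m j)) u v) ∧
    T = algTypeOfBlocks μ n m

/-- The skew-symmetric form `𝒜ₓ(u, v) = ⟨x, [u, v]⟩` on a Lie algebra `𝔤`, for `x ∈ 𝔤*`. -/
def lieForm {𝔤 : Type*} [LieRing 𝔤] [LieAlgebra ℂ 𝔤] (x : Module.Dual ℂ 𝔤) :
    LinearMap.BilinForm ℂ 𝔤 :=
  LinearMap.mk₂ ℂ (fun u v => x ⁅u, v⁆) (by simp) (by simp) (by simp) (by simp)

/-- Zariski open subsets of a finite-dimensional complex vector space: complements of common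
zero sets of polynomials in the linear functionals. -/
def IsZariskiOpen {W : Type*} [AddCommGroup W] [Module ℂ W] (U : Set W) : Prop :=
  ∃ S : Set (MvPolynomial (Module.Dual ℂ W) ℂ),
    U = {w | ∃ F ∈ S, MvPolynomial.eval (fun φ : Module.Dual ℂ W => φ w) F ≠ 0}

/-- The Jordan–Kronecker invariants of `𝔤` are given by `T`: the pencil `𝒜ₓ + λ 𝒜ₐ` has
algebraic type `T` for all `(x, a)` in a non-empty Zariski open subset of `𝔤* × 𝔤*`. -/
def HasJKInvariants (𝔤 : Type*) [LieRing 𝔤] [LieAlgebra ℂ 𝔤] (T : AlgType) : Prop :=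
  ∃ U : Set (Module.Dual ℂ 𝔤 × Module.Dual ℂ 𝔤),
    IsZariskiOpen U ∧ U.Nonempty ∧ ∀ w ∈ U, HasAlgType (lieForm w.1) (lieForm w.2) T

/-- The type consisting of the Jordan tuples `(2 n_{t1}, …, 2 n_{t s_t})`, `t = 1, …, p`, and
`r` trivial Kronecker blocks. -/
def trivialKroneckerType {p : ℕ} {s : Fin p → ℕ} (n : (t : Fin p) → Fin (s t) → ℕ) (r : ℕ) :
    AlgType where
  jordan := Finset.univ.val.map fun t => Finset.univ.val.map fun i => 2 * n t i
  kronecker := Multiset.replicate r 1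

/-- The maximum of the tuple is attained at least twice. -/
def HasMultipleMaxima {s : ℕ} (n : Fin s → ℕ) : Prop :=
  ∃ i j, i ≠ j ∧ n i = n j ∧ ∀ l, n l ≤ n i

/-- `𝔤` has a basis `h_l`, `e^i_{tj}`, `f^i_{tj}` (`1 ≤ j ≤ n_{ti}`) whose only nonzero brackets
are `[e^i_{tj}, f^i_{tk}] = e^i_{t,j-k}` for `j > k` and
`[e^i_{tj}, f^i_{tj}] = ∑_l c_{tl} h_l`, up to skew-symmetry.
In the code all indices start at `0`. -/
def IsHeisenbergType (𝔤 : Type*) [LieRing 𝔤] [LieAlgebra ℂ 𝔤] {p : ℕ} {s : Fin p → ℕ}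
    (n : (t : Fin p) → Fin (s t) → ℕ) {r : ℕ} (c : Fin p → Fin r → ℂ) : Prop :=
  ∃ b : Module.Basis
      (Fin r ⊕ ((Σ t, Σ i : Fin (s t), Fin (n t i)) ⊕ (Σ t, Σ i : Fin (s t), Fin (n t i)))) ℂ 𝔤,
    let h : Fin r → 𝔤 := fun l => b (Sum.inl l)
    let e : (t : Fin p) → (i : Fin (s t)) → Fin (n t i) → 𝔤 :=
      fun t i j => b (Sum.inr (Sum.inl ⟨t, i, j⟩))
    let f : (t : Fin p) → (i : Fin (s t)) → Fin (n t i) → 𝔤 :=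
      fun t i j => b (Sum.inr (Sum.inr ⟨t, i, j⟩))
    (∀ (l : Fin r) (v : 𝔤), ⁅h l, v⁆ = 0) ∧
    (∀ t i j t' i' k, ⁅e t i j, e t' i' k⁆ = 0) ∧
    (∀ t i j t' i' k, ⁅f t i j, f t' i' k⁆ = 0) ∧
    (∀ t i j t' i' k, (⟨t, i⟩ : Σ t, Fin (s t)) ≠ ⟨t', i'⟩ → ⁅e t i j, f t' i' k⁆ = 0) ∧
    (∀ t i (j k : Fin (n t i)), k < j →
      ⁅e t i j, f t i k⁆ = e t i ⟨j.val - k.val - 1, by omega⟩) ∧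
    (∀ t i (j : Fin (n t i)), ⁅e t i j, f t i j⁆ = ∑ l, c t l • h l) ∧
    (∀ t i (j k : Fin (n t i)), j < k → ⁅e t i j, f t i k⁆ = 0)

end JordanKronecker

end

/-! Let `B` be a commutative algebra, `W` an ideal and `κ_1, …, κ_r` elements of `B`. A parameter `ξ
= (w, c)` in `V = W × ℂʳ` stands for the element `w + ∑ c_l κ_l`, and `W` acts on `V` by multiplying
this element into `W × 0`. These operators commute, so `W ⋉ V*` is a Lie algebra. Its bracket lies
in `V*`, hence `𝒜ₓ` depends only on the parameter `ξ` that `x` defines, and it pairs `V*` with `W`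
through multiplication by `ξ`. If the element of `α` is a unit, the pencil of `ξ` and `α` has the
Jordan blocks of multiplication by `ξ/α` on `W`, while the covectors killing `W × 0` give `r`
trivial Kronecker blocks (`hasAlgType_of_jordan_chains`).

`B` consists of families of truncated polynomials in `y`, one for each block, with equal constant
terms within a tuple. An ordinary block of half-size `n` is truncated at `y ^ (n + 1)` and its chain
starts from `y`. In a tuple with a unique maximum the maximal block may be distinguished: it is
truncated at `y ^ n`, and its chain starts from the idempotent of the whole tuple. Strict maximality
ensures that `n` factors without constant term kill this idempotent in the other components too. The
eigenvalue of `ξ/α` on a tuple is its constant term there, and a nonzero linear coefficient keeps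
each chain at full length (`pow_len_smul_top`, `linearIndependent_pow_smul_top`).

Tuples with a distinguished block have their constant terms in `W`, hence free eigenvalues; the
others take theirs from `ℂʳ`. One such tuple is manageable with `r = 1`; for `r ≥ 2` the scalars
`(1, t)` separate any number of them. With no distinguished blocks, monomials and dual coordinates
form the Heisenberg-type basis (`isHeisenbergType`). -/

noncomputable section

namespace JordanKronecker

/-! ### Linear independence of Jordan chains -/

section JordanChains

/-- The Jordan operator on coordinate vectors indexed by a family of chains. -/
def chainOperator {K : Type} (n : K → ℕ) (μ : K → ℂ) :
    Module.End ℂ ((Σ κ, Fin (n κ)) → ℂ) where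
  toFun v q := μ q.1 * v q + if h : q.2.val + 1 < n q.1 then v ⟨q.1, ⟨q.2.val + 1, h⟩⟩ else 0
  map_add' v v' := by
    funext q
    by_cases h : q.2.val + 1 < n q.1 <;> simp [h] <;> ring
  map_smul' c v := by
    funext q
    by_cases h : q.2.val + 1 < n q.1 <;> simp [h] <;> ring

lemma sum_jordan_chain {W : Type*} [AddCommGroup W] [Module ℂ W] (L : Module.End ℂ W) (μ : ℂ)
    {n : ℕ} (w : Fin n → W) (h0 : ∀ h : 0 < n, L (w ⟨0, h⟩) = μ • w ⟨0, h⟩)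
    (hs : ∀ k (h : k + 1 < n), L (w ⟨k + 1, h⟩) = μ • w ⟨k + 1, h⟩ + w ⟨k, by omega⟩)
    (v : Fin n → ℂ) :
    ∑ k, v k • L (w k) =
      ∑ k, (μ * v k + if h : k.val + 1 < n then v ⟨k.val + 1, h⟩ else 0) • w k := by
  cases n with
  | zero => simp
  | succ n =>
    have hL : ∑ k, v k • L (w k) = ∑ k, (μ * v k) • w k + ∑ k : Fin n, v k.succ • w k.castSucc := by
      rw [Fin.sum_univ_succ, Fin.sum_univ_succ (f := fun k => (μ * v k) • w k), add_assoc,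
        ← Finset.sum_add_distrib]
      congr 1
      · have := h0 (Nat.succ_pos n)
        rw [show (⟨0, Nat.succ_pos n⟩ : Fin (n + 1)) = 0 from rfl] at this
        rw [this, smul_smul, mul_comm]
      · refine Finset.sum_congr rfl fun k _ => ?_
        have := hs k.val (by omega)
        rw [show (⟨k.val + 1, by omega⟩ : Fin (n + 1)) = k.succ from rfl,
          show (⟨k.val, by omega⟩ : Fin (n + 1)) = k.castSucc from rfl] at this
        rw [this, smul_add, smul_smul, mul_comm]
    rw [hL]
    simp only [add_smul, Finset.sum_add_distrib]
    congr 1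
    rw [Fin.sum_univ_castSucc]
    simp [Fin.succ]

/-- Jordan chains are linearly independent if their eigenvectors are. -/
theorem linearIndependent_jordan_chains {W : Type*} [AddCommGroup W] [Module ℂ W] {K : Type}
    [Fintype K] (n : K → ℕ) (hn : ∀ κ, 0 < n κ) (μ : K → ℂ) (L : Module.End ℂ W)
    (w : (Σ κ, Fin (n κ)) → W) (h0 : ∀ κ, L (w ⟨κ, ⟨0, hn κ⟩⟩) = μ κ • w ⟨κ, ⟨0, hn κ⟩⟩)
    (hs : ∀ κ k (h : k + 1 < n κ),
      L (w ⟨κ, ⟨k + 1, h⟩⟩) = μ κ • w ⟨κ, ⟨k + 1, h⟩⟩ + w ⟨κ, ⟨k, by omega⟩⟩)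
    (hend : LinearIndependent ℂ fun κ => w ⟨κ, ⟨0, hn κ⟩⟩) : LinearIndependent ℂ w := by
  classical
  set Φ : ((Σ κ, Fin (n κ)) → ℂ) →ₗ[ℂ] W := Fintype.linearCombination ℂ w with hΦ
  have hΦs : ∀ v, Φ v = ∑ κ, ∑ k, v ⟨κ, k⟩ • w ⟨κ, k⟩ := fun v => by
    rw [hΦ, Fintype.linearCombination_apply, Fintype.sum_sigma]
  have hcomm : ∀ v, L (Φ v) = Φ (chainOperator n μ v) := fun v => by
    rw [hΦs, hΦs, map_sum]
    refine Finset.sum_congr rfl fun κ _ => ?_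
    rw [map_sum]
    simp only [map_smul]
    exact sum_jordan_chain L (μ κ) (fun k => w ⟨κ, k⟩) (fun _ => h0 κ) (fun k h => hs κ k h) _
  -- The relations among the chain vectors form an invariant subspace, so a nonzero space of
  -- relations contains an eigenvector of the Jordan operator.
  have hker : ∀ v ∈ LinearMap.ker Φ, chainOperator n μ v ∈ LinearMap.ker Φ := fun v hv => by
    rw [LinearMap.mem_ker] at hv ⊢
    rw [← hcomm, hv, map_zero]
  rw [linearIndependent_iff_injective_fintypeLinearCombination, ← hΦ]
  rw [← LinearMap.ker_eq_bot]
  by_contra hne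
  have : Nontrivial (LinearMap.ker Φ) := Submodule.nontrivial_iff_ne_bot.mpr hne
  obtain ⟨ν, hν⟩ := Module.End.exists_eigenvalue ((chainOperator n μ).restrict hker)
  obtain ⟨⟨v, hv⟩, hve⟩ := hν.exists_hasEigenvector
  have hv0 : v ≠ 0 := fun h => hve.2 (Subtype.ext h)
  have heig : chainOperator n μ v = ν • v := congrArg Subtype.val hve.apply_eq_smul
  have hcoord : ∀ κ (k : Fin (n κ)), μ κ * v ⟨κ, k⟩ +
      (if h : k.val + 1 < n κ then v ⟨κ, ⟨k.val + 1, h⟩⟩ else 0) = ν * v ⟨κ, k⟩ :=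
    fun κ k => congrFun heig ⟨κ, k⟩
  -- Such an eigenvector lives on the chain ends, so it is a relation among the eigenvectors `w ⟨κ,
  -- 0⟩` alone.
  have hpos : ∀ κ (k : Fin (n κ)), k.val ≠ 0 → v ⟨κ, k⟩ = 0 := by
    intro κ k hk
    by_cases hμ : μ κ = ν
    · have := hcoord κ ⟨k.val - 1, by omega⟩
      have hk' : k.val - 1 + 1 = k.val := by omega
      simp only [hμ, hk', k.isLt, dif_pos, Fin.eta] at this
      simpa using this
    -- `d` is the distance to the last index of the chain; for `μ κ ≠ ν` the coordinates vanish from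
    -- there downwards.
    · obtain ⟨d, hd⟩ : ∃ d, k.val + d + 1 = n κ := ⟨n κ - 1 - k.val, by omega⟩
      clear hk
      induction d generalizing k with
      | zero =>
        have := hcoord κ k
        rw [dif_neg (by omega), add_zero] at this
        exact (mul_eq_mul_right_iff.mp this).resolve_left hμ
      | succ d ih =>
        have := hcoord κ k
        rw [dif_pos (by omega), ih ⟨k.val + 1, by omega⟩ (by simp only; omega), add_zero] at this
        exact (mul_eq_mul_right_iff.mp this).resolve_left hμ
  apply hv0
  have hsum : ∑ κ, v ⟨κ, ⟨0, hn κ⟩⟩ • w ⟨κ, ⟨0, hn κ⟩⟩ = 0 := by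
    rw [← LinearMap.mem_ker.mp hv, hΦs]
    refine Finset.sum_congr rfl fun κ _ => ?_
    rw [Finset.sum_eq_single_of_mem ⟨0, hn κ⟩ (Finset.mem_univ _)]
    intro k _ hk
    rw [hpos κ k (fun h => hk (Fin.ext h)), zero_smul]
  have hz := Fintype.linearIndependent_iff.mp hend _ hsum
  funext ⟨κ, k⟩
  by_cases hk : k.val = 0
  · have : k = ⟨0, hn κ⟩ := Fin.ext hk
    rw [this]
    exact hz κ
  · exact hpos κ k hk

end JordanChains

/-! ### The Lie algebra of an ideal acting on its parameter space -/

section SemidirectAlgebra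

variable {B : Type} [CommRing B] [Algebra ℂ B] (W : Ideal B) {r : ℕ} (κ : Fin r → B)

/-- The parameter space `W × ℂʳ`. -/
abbrev Param (W : Ideal B) (r : ℕ) : Type := W × (Fin r → ℂ)

/-- The element `w + ∑ cₗ κₗ` of `B` given by a parameter `(w, c)`. -/
def paramElt : Param W r →ₗ[ℂ] B :=
  (W.subtype.restrictScalars ℂ).coprod (Fintype.linearCombination ℂ κ)

lemma paramElt_apply (ξ : Param W r) :
    paramElt W κ ξ = (ξ.1 : B) + ∑ l, ξ.2 l • κ l := rfl

/-- The action of `w : W` on the parameter space, `ξ ↦ (paramElt ξ • w, 0)`. -/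
def paramAct : W →ₗ[ℂ] Param W r →ₗ[ℂ] Param W r :=
  LinearMap.mk₂ ℂ (fun w ξ => (paramElt W κ ξ • w, 0))
    (by intros; ext <;> simp)
    (by intros; ext <;> simp)
    (by intros; ext <;> simp [add_mul])
    (by intros; ext <;> simp)

lemma paramAct_apply (w : W) (ξ : Param W r) :
    paramAct W κ w ξ = (paramElt W κ ξ • w, 0) := rfl

/-- Either composite multiplies the element of `ξ` by `w * w'`. This commutation is what the Jacobi
identity comes down to. -/
lemma paramAct_comm (w w' : W) (ξ : Param W r) :
    paramAct W κ w (paramAct W κ w' ξ) = paramAct W κ w' (paramAct W κ w ξ) := by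
  simp only [paramAct_apply, paramElt_apply]
  ext
  · simp only [Pi.zero_apply, zero_smul, Finset.sum_const_zero, add_zero, smul_eq_mul,
      Submodule.coe_smul]
    ring
  · rfl

/-- The semidirect product of the abelian algebra `W` with the dual of its parameter space. -/
def SemidirectAlg (_κ : Fin r → B) : Type := W × Module.Dual ℂ (Param W r)

instance : AddCommGroup (SemidirectAlg W κ) :=
  inferInstanceAs (AddCommGroup (W × Module.Dual ℂ (Param W r)))

instance : Module ℂ (SemidirectAlg W κ) :=
  inferInstanceAs (Module ℂ (W × Module.Dual ℂ (Param W r)))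

instance [FiniteDimensional ℂ W] : FiniteDimensional ℂ (SemidirectAlg W κ) :=
  inferInstanceAs (FiniteDimensional ℂ (W × Module.Dual ℂ (Param W r)))

instance : Bracket (SemidirectAlg W κ) (SemidirectAlg W κ) where
  bracket a b := (0, a.2 ∘ₗ paramAct W κ b.1 - b.2 ∘ₗ paramAct W κ a.1)

variable {W κ}

lemma SemidirectAlg.ext' {a b : SemidirectAlg W κ} (h1 : a.1 = b.1)
    (h2 : ∀ ξ, a.2 ξ = b.2 ξ) : a = b := Prod.ext h1 (LinearMap.ext h2)

@[simp] lemma SemidirectAlg.lie_fst (a b : SemidirectAlg W κ) : (⁅a, b⁆ : SemidirectAlg W κ).1 = 0 :=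
  rfl

@[simp] lemma SemidirectAlg.lie_snd (a b : SemidirectAlg W κ) (ξ : Param W r) :
    (⁅a, b⁆ : SemidirectAlg W κ).2 ξ = a.2 (paramAct W κ b.1 ξ) - b.2 (paramAct W κ a.1 ξ) := rfl

@[simp] lemma SemidirectAlg.add_fst (a b : SemidirectAlg W κ) : (a + b).1 = a.1 + b.1 := rfl

@[simp] lemma SemidirectAlg.add_snd (a b : SemidirectAlg W κ) : (a + b).2 = a.2 + b.2 := rfl

@[simp] lemma SemidirectAlg.smul_fst (c : ℂ) (a : SemidirectAlg W κ) : (c • a).1 = c • a.1 := rfl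

@[simp] lemma SemidirectAlg.smul_snd (c : ℂ) (a : SemidirectAlg W κ) : (c • a).2 = c • a.2 := rfl

@[simp] lemma SemidirectAlg.zero_fst : (0 : SemidirectAlg W κ).1 = 0 := rfl

@[simp] lemma SemidirectAlg.zero_snd : (0 : SemidirectAlg W κ).2 = 0 := rfl

instance : LieRing (SemidirectAlg W κ) where
  add_lie a b c := SemidirectAlg.ext' (by simp) (fun ξ => by simp; ring)
  lie_add a b c := SemidirectAlg.ext' (by simp) (fun ξ => by simp; ring)
  lie_self a := SemidirectAlg.ext' (by simp) (fun ξ => by simp)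
  leibniz_lie a b c := SemidirectAlg.ext' (by simp) (fun ξ => by
    simp only [SemidirectAlg.lie_snd, SemidirectAlg.lie_fst, map_zero, LinearMap.zero_apply,
      SemidirectAlg.add_snd, LinearMap.add_apply, paramAct_comm W κ c.1 b.1 ξ,
      paramAct_comm W κ c.1 a.1 ξ, paramAct_comm W κ b.1 a.1 ξ]
    ring)

instance : LieAlgebra ℂ (SemidirectAlg W κ) where
  lie_smul c a b := SemidirectAlg.ext' (by simp) (fun ξ => by simp; ring)

/-- Brackets have zero component in `W`, so only the restriction of `x` to the dual summand enters.
-/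
lemma SemidirectAlg.lieForm_apply (x : Module.Dual ℂ (SemidirectAlg W κ)) (ξ : Param W r)
    (hx : ∀ φ : Module.Dual ℂ (Param W r), x ((0, φ) : W × Module.Dual ℂ (Param W r)) = φ ξ)
    (a b : SemidirectAlg W κ) :
    lieForm x a b = a.2 (paramAct W κ b.1 ξ) - b.2 (paramAct W κ a.1 ξ) :=
  hx _

end SemidirectAlgebra

/-! ### From Jordan chains in the ideal to the canonical form of the pencil -/

section BlockBasis

variable {B : Type} [CommRing B] [Algebra ℂ B] {W : Ideal B} {r : ℕ} {κ : Fin r → B}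

/-- Reorder a basis indexed by chains of `W`, chains of the dual and trivial blocks. -/
def blockEquiv {K : Type} (n : K → ℕ) (r : ℕ) :
    (Σ i, Fin (n i)) ⊕ ((Σ i, Fin (n i)) ⊕ Fin r) ≃
      (Σ i, Fin (n i) ⊕ Fin (n i)) ⊕ (Σ _ : Fin r, Fin 0 ⊕ Fin (0 + 1)) where
  toFun
    -- Chains of `W` form the second half of each block, so that the pairing of `V*` with `W` is the
    -- upper right corner of `skewBlock`.
    | Sum.inl ⟨i, k⟩ => Sum.inl ⟨i, Sum.inr k⟩
    | Sum.inr (Sum.inl ⟨i, k⟩) => Sum.inl ⟨i, Sum.inl k⟩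
    | Sum.inr (Sum.inr l) => Sum.inr ⟨l, Sum.inr 0⟩
  invFun
    | Sum.inl ⟨i, Sum.inr k⟩ => Sum.inl ⟨i, k⟩
    | Sum.inl ⟨i, Sum.inl k⟩ => Sum.inr (Sum.inl ⟨i, k⟩)
    | Sum.inr ⟨l, _⟩ => Sum.inr (Sum.inr l)
  left_inv := by rintro (⟨i, k⟩ | ⟨i, k⟩ | l) <;> rfl
  right_inv := by
    rintro (⟨i, k | k⟩ | ⟨l, k | k⟩)
    · rfl
    · rfl
    · exact k.elim0
    · have : k = 0 := Fin.ext (by omega)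
      subst this
      rfl

/-- The basis of the semidirect product in which the pencil is block-diagonal. -/
def blockBasis {K : Type} {n : K → ℕ} (bW : Module.Basis (Σ i, Fin (n i)) ℂ W)
    (bV : Module.Basis ((Σ i, Fin (n i)) ⊕ Fin r) ℂ (Module.Dual ℂ (Param W r))) :
    Module.Basis ((Σ i, Fin (n i) ⊕ Fin (n i)) ⊕ (Σ _ : Fin r, Fin 0 ⊕ Fin (0 + 1))) ℂ
      (SemidirectAlg W κ) :=
  ((bW.prod bV).reindex (blockEquiv n r) :
    Module.Basis _ ℂ (W × Module.Dual ℂ (Param W r)))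

section
variable {K : Type} {n : K → ℕ} (bW : Module.Basis (Σ i, Fin (n i)) ℂ W)
  (bV : Module.Basis ((Σ i, Fin (n i)) ⊕ Fin r) ℂ (Module.Dual ℂ (Param W r)))

lemma blockBasis_inl_inl (i : K) (k : Fin (n i)) :
    (blockBasis bW bV (Sum.inl ⟨i, Sum.inl k⟩) : SemidirectAlg W κ) =
      ((0, bV (Sum.inl ⟨i, k⟩)) : W × Module.Dual ℂ (Param W r)) := by
  have : (blockEquiv n r).symm (Sum.inl ⟨i, Sum.inl k⟩) = Sum.inr (Sum.inl ⟨i, k⟩) := rfl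
  change (bW.prod bV).reindex (blockEquiv n r) _ = _
  rw [Module.Basis.reindex_apply, this]
  refine Prod.ext ?_ ?_ <;> simp

lemma blockBasis_inl_inr (i : K) (k : Fin (n i)) :
    (blockBasis bW bV (Sum.inl ⟨i, Sum.inr k⟩) : SemidirectAlg W κ) =
      ((bW ⟨i, k⟩, 0) : W × Module.Dual ℂ (Param W r)) := by
  have : (blockEquiv n r).symm (Sum.inl ⟨i, Sum.inr k⟩) = Sum.inl ⟨i, k⟩ := rfl
  change (bW.prod bV).reindex (blockEquiv n r) _ = _
  rw [Module.Basis.reindex_apply, this]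
  refine Prod.ext ?_ ?_ <;> simp

lemma blockBasis_inr (l : Fin r) (k : Fin 0 ⊕ Fin (0 + 1)) :
    (blockBasis bW bV (Sum.inr ⟨l, k⟩) : SemidirectAlg W κ) =
      ((0, bV (Sum.inr l)) : W × Module.Dual ℂ (Param W r)) := by
  have : (blockEquiv n r).symm (Sum.inr ⟨l, k⟩) = Sum.inr (Sum.inr l) := rfl
  change (bW.prod bV).reindex (blockEquiv n r) _ = _
  rw [Module.Basis.reindex_apply, this]
  refine Prod.ext ?_ ?_ <;> simp

/-- The Gram matrix of `𝒜ₓ` in the block basis. -/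
lemma lieForm_blockBasis [DecidableEq K] (x : Module.Dual ℂ (SemidirectAlg W κ)) (ξ : Param W r)
    (hx : ∀ φ : Module.Dual ℂ (Param W r), x ((0, φ) : W × Module.Dual ℂ (Param W r)) = φ ξ)
    (M : (i : K) → Matrix (Fin (n i)) (Fin (n i)) ℂ)
    (N : Fin r → Matrix (Fin 0 ⊕ Fin (0 + 1)) (Fin 0 ⊕ Fin (0 + 1)) ℂ) (hN : ∀ l, N l = 0)
    (hM : ∀ u v, bV (Sum.inl u) (paramAct W κ (bW v) ξ) = Matrix.blockDiagonal' M u v)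
    (hl : ∀ l v, bV (Sum.inr l) (paramAct W κ (bW v) ξ) = 0)
    (u v : (Σ i, Fin (n i) ⊕ Fin (n i)) ⊕ (Σ _ : Fin r, Fin 0 ⊕ Fin (0 + 1))) :
    lieForm x (blockBasis bW bV u) (blockBasis bW bV v) =
      Matrix.fromBlocks (Matrix.blockDiagonal' fun i => skewBlock (M i)) 0
        0 (Matrix.blockDiagonal' N) u v := by
  have hN' : Matrix.blockDiagonal' N = 0 := by
    rw [show N = 0 from funext hN]
    exact Matrix.blockDiagonal'_zero
  rw [SemidirectAlg.lieForm_apply x ξ hx, hN']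
  rcases u with ⟨i, j | j⟩ | ⟨l, j⟩ <;> rcases v with ⟨i', k | k⟩ | ⟨l', k⟩ <;>
    simp only [blockBasis_inl_inl, blockBasis_inl_inr, blockBasis_inr, hM, hl, map_zero,
      LinearMap.zero_apply, sub_zero, zero_sub, Matrix.fromBlocks_apply₁₁,
      Matrix.fromBlocks_apply₁₂, Matrix.fromBlocks_apply₂₁, Matrix.fromBlocks_apply₂₂,
      Matrix.zero_apply]
  all_goals
    by_cases h : i = i'
    · subst h
      simp [skewBlock]
    · simp [Matrix.blockDiagonal'_apply_ne _ _ _ h, Matrix.blockDiagonal'_apply_ne _ _ _ (Ne.symm h)]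

end

lemma kroneckerA_zero : kroneckerA 0 = 0 := by
  ext (i | i) (j | j)
  · exact i.elim0
  · exact i.elim0
  · exact j.elim0
  · rfl

lemma kroneckerB_zero : kroneckerB 0 = 0 := by
  ext (i | i) (j | j)
  · exact i.elim0
  · exact i.elim0
  · exact j.elim0
  · rfl

/-- If multiplication by the quotient of the parameter elements of `ξ` and `α` has Jordan chains
of lengths `n i` with eigenvalues `μ i` filling `W`, then the pencil has the corresponding Jordan
blocks and `r` trivial Kronecker blocks. -/
theorem hasAlgType_of_jordan_chains [FiniteDimensional ℂ W]
    (x a : Module.Dual ℂ (SemidirectAlg W κ)) (ξ α : Param W r)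
    (hx : ∀ φ : Module.Dual ℂ (Param W r), x ((0, φ) : W × Module.Dual ℂ (Param W r)) = φ ξ)
    (ha : ∀ φ : Module.Dual ℂ (Param W r), a ((0, φ) : W × Module.Dual ℂ (Param W r)) = φ α)
    (u : B) (hu : paramElt W κ α * u = 1) {K : Type} [Fintype K] [DecidableEq K] (n : K → ℕ)
    (hn : ∀ i, 0 < n i) (μ : K → ℂ) (top : K → W)
    (htop : ∀ i, (u * paramElt W κ ξ - algebraMap ℂ B (μ i)) ^ n i • top i = 0)
    (hend : LinearIndependent ℂ fun i =>
      (u * paramElt W κ ξ - algebraMap ℂ B (μ i)) ^ (n i - 1) • top i)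
    (hdim : Module.finrank ℂ W ≤ ∑ i, n i) :
    HasAlgType (lieForm x) (lieForm a)
      (algTypeOfBlocks (fun i => (μ i : OnePoint ℂ)) n (fun _ : Fin r => 0)) := by
  set γ := u * paramElt W κ ξ with hγ
  -- The exponent decreases with the index: index `0` is the eigenvector and the last index is
  -- `top`, matching the superdiagonal of `jordanMatrix`.
  set w : (Σ i, Fin (n i)) → W := fun q =>
    (γ - algebraMap ℂ B (μ q.1)) ^ (n q.1 - 1 - q.2.val) • top q.1 with hw
  have hstep : ∀ i (v : W), γ • v = μ i • v + (γ - algebraMap ℂ B (μ i)) • v := fun i v => by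
    rw [sub_smul, algebraMap_smul]
    abel
  have hw0 : ∀ i, γ • w ⟨i, ⟨0, hn i⟩⟩ = μ i • w ⟨i, ⟨0, hn i⟩⟩ := fun i => by
    rw [hstep i, add_eq_left, hw]
    simp only
    rw [smul_smul, ← pow_succ', show n i - 1 - 0 + 1 = n i by have := hn i; omega, htop]
  have hws : ∀ i k (h : k + 1 < n i),
      γ • w ⟨i, ⟨k + 1, h⟩⟩ = μ i • w ⟨i, ⟨k + 1, h⟩⟩ + w ⟨i, ⟨k, by omega⟩⟩ := fun i k h => by
    rw [hstep i, add_right_inj, hw]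
    simp only
    rw [smul_smul, ← pow_succ', show n i - 1 - (k + 1) + 1 = n i - 1 - k by omega]
  have hli : LinearIndependent ℂ w := by
    refine linearIndependent_jordan_chains n hn μ (Algebra.lsmul ℂ ℂ W γ) w hw0 hws ?_
    simpa [hw] using hend
  have hcard : Fintype.card (Σ i, Fin (n i)) = Module.finrank ℂ W := by
    refine le_antisymm hli.fintype_card_le_finrank ?_
    simpa using hdim
  have hspan := hli.span_eq_top_of_card_eq_finrank' hcard
  set bW : Module.Basis (Σ i, Fin (n i)) ℂ W := Module.Basis.mk hli hspan.ge with hbW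
  have hbWw : ∀ q, bW q = w q := fun q => Module.Basis.mk_apply hli hspan.ge q
  set A : W ≃ₗ[ℂ] W :=
    { Algebra.lsmul ℂ ℂ W (paramElt W κ α) with
      invFun := fun v => u • v
      left_inv := fun v => by
        change u • paramElt W κ α • v = v
        rw [smul_smul, mul_comm, hu, one_smul]
      right_inv := fun v => by
        change paramElt W κ α • u • v = v
        rw [smul_smul, hu, one_smul] } with hA
  have hAv : ∀ v, A v = paramElt W κ α • v := fun v => rfl
  -- Twisting the chain basis by multiplication by `α` turns the second form into the identity and
  -- the first into the matrix of `γ`.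
  set c : Module.Basis ((Σ i, Fin (n i)) ⊕ Fin r) ℂ (Param W r) :=
    (bW.map A).prod (Pi.basisFun ℂ (Fin r)) with hc
  have hcl : ∀ q, c (Sum.inl q) = (A (w q), 0) := fun q => by
    rw [← hbWw]
    ext <;> simp [hc]
  have hα : ∀ q, paramAct W κ (bW q) α = c (Sum.inl q) := fun q => by
    rw [hcl, hbWw]
    rfl
  have hξ : ∀ q, paramAct W κ (bW q) ξ = (A (γ • w q), 0) := fun q => by
    rw [paramAct_apply, hbWw, hAv, smul_smul _ γ (w q), hγ, ← mul_assoc, hu, one_mul]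
  have hξ0 : ∀ i, paramAct W κ (bW ⟨i, ⟨0, hn i⟩⟩) ξ = μ i • c (Sum.inl ⟨i, ⟨0, hn i⟩⟩) :=
    fun i => by
      rw [hξ, hw0, hcl, map_smul]
      simp
  have hξs : ∀ i k (h : k + 1 < n i), paramAct W κ (bW ⟨i, ⟨k + 1, h⟩⟩) ξ =
      μ i • c (Sum.inl ⟨i, ⟨k + 1, h⟩⟩) + c (Sum.inl ⟨i, ⟨k, by omega⟩⟩) := fun i k h => by
    rw [hξ, hws, hcl, hcl, map_add, map_smul]
    simp
  refine ⟨K, Fin r, inferInstance, inferInstance, inferInstance, inferInstance, _, n, fun _ => 0,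
    blockBasis bW c.dualBasis, hn, ?_, ?_, rfl⟩
  · refine lieForm_blockBasis bW c.dualBasis x ξ hx (fun i => jordanMatrix (n i) (μ i)) _
      (fun _ => kroneckerA_zero) ?_ ?_
    · rintro ⟨i, j⟩ ⟨i', k, hk⟩
      rcases k with _ | k
      · rw [hξ0, map_smul, Module.Basis.dualBasis_apply_self]
        by_cases h : i = i'
        · subst h
          rw [Matrix.blockDiagonal'_apply_eq]
          by_cases hj : j = ⟨0, hk⟩
          · simp [hj, jordanMatrix]
          · have : (⟨0, hk⟩ : Fin (n i)) ≠ j := Ne.symm hj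
            simp [hj, jordanMatrix, this]
        · rw [Matrix.blockDiagonal'_apply_ne _ _ _ h]
          have : ¬ (i' = i) := fun h' => h h'.symm
          simp [this]
      · rw [hξs, map_add, map_smul, Module.Basis.dualBasis_apply_self,
          Module.Basis.dualBasis_apply_self]
        by_cases h : i = i'
        · subst h
          rw [Matrix.blockDiagonal'_apply_eq]
          simp only [jordanMatrix, Matrix.of_apply, Sum.inl.injEq, Sigma.mk.injEq, heq_eq_eq,
            true_and, Fin.ext_iff, smul_eq_mul]
          by_cases hj : j.val = k + 1
          · simp [hj]
          · have h1 : ¬ (k + 1 = j.val) := fun h => hj h.symm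
            simp [hj, h1, eq_comm]
        · rw [Matrix.blockDiagonal'_apply_ne _ _ _ h]
          have : ¬ (i' = i) := fun h' => h h'.symm
          simp [this]
    -- The action takes values in `W × 0`, where the dual coordinates of `ℂʳ` vanish; these
    -- covectors are the trivial blocks.
    · rintro l ⟨i', k, hk⟩
      rcases k with _ | k
      · rw [hξ0, map_smul, Module.Basis.dualBasis_apply_self]
        simp
      · rw [hξs, map_add, map_smul, Module.Basis.dualBasis_apply_self,
          Module.Basis.dualBasis_apply_self]
        simp
  · refine lieForm_blockBasis bW c.dualBasis a α ha (fun i => 1) _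
      (fun _ => kroneckerB_zero) ?_ ?_
    · intro p q
      rw [hα, Module.Basis.dualBasis_apply_self]
      change _ = Matrix.blockDiagonal' (1 : (i : K) → Matrix (Fin (n i)) (Fin (n i)) ℂ) p q
      rw [Matrix.blockDiagonal'_one, Matrix.one_apply]
      simp [eq_comm]
    · intro l q
      rw [hα, Module.Basis.dualBasis_apply_self]
      simp

end BlockBasis

/-! ### Zariski open sets and grouping of blocks by eigenvalue -/

/-- Complements of the zero set of finitely many polynomials, none of which may vanish. -/
lemma isZariskiOpen_of_forall_ne_zero {V ι : Type*} [AddCommGroup V] [Module ℂ V] [Fintype ι]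
    (F : ι → MvPolynomial (Module.Dual ℂ V) ℂ) :
    IsZariskiOpen {w : V | ∀ i, MvPolynomial.eval (fun φ : Module.Dual ℂ V => φ w) (F i) ≠ 0} :=
  ⟨{∏ i, F i}, by ext w; simp [Finset.prod_ne_zero_iff]⟩

/-- The type of blocks grouped by the first component of their index. -/
lemma algTypeOfBlocks_sigma {p : ℕ} {s : Fin p → ℕ} (hs : ∀ t, 0 < s t)
    (n : (t : Fin p) → Fin (s t) → ℕ) (r : ℕ) (μ : Fin p → ℂ) (hμ : Function.Injective μ) :
    algTypeOfBlocks (fun q : Σ t, Fin (s t) => (μ q.1 : OnePoint ℂ)) (fun q => n q.1 q.2)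
      (fun _ : Fin r => 0) = trivialKroneckerType n r := by
  classical
  ext1
  · have himg : (Finset.univ.image fun q : Σ t, Fin (s t) => (μ q.1 : OnePoint ℂ)) =
        Finset.univ.map ⟨fun t => (μ t : OnePoint ℂ), OnePoint.coe_injective.comp hμ⟩ := by
      ext ν
      simp only [Finset.mem_image, Finset.mem_univ, true_and, Finset.mem_map,
        Function.Embedding.coeFn_mk]
      -- Nonempty tuples are needed here: each `μ t` must occur as the eigenvalue of some block.
      exact ⟨fun ⟨q, hq⟩ => ⟨q.1, hq⟩, fun ⟨t, ht⟩ => ⟨⟨t, ⟨0, hs t⟩⟩, ht⟩⟩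
    have hfil : ∀ t, (Finset.univ.filter fun q : Σ t, Fin (s t) =>
        (μ q.1 : OnePoint ℂ) = (μ t : OnePoint ℂ)) =
        Finset.univ.map ⟨fun i => (⟨t, i⟩ : Σ t, Fin (s t)),
          fun _ _ h => by simpa using h⟩ := by
      intro t
      ext ⟨t', i⟩
      simp only [Finset.mem_filter, Finset.mem_univ, true_and, Finset.mem_map]
      constructor
      · intro h
        have : t' = t := hμ (OnePoint.coe_injective h)
        subst this
        exact ⟨i, rfl⟩
      · rintro ⟨j, hj⟩
        rw [← (Sigma.mk.inj hj).1]
    simp only [algTypeOfBlocks, trivialKroneckerType]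
    rw [himg, Finset.map_val, Multiset.map_map]
    refine Multiset.map_congr rfl fun t _ => ?_
    simp only [Function.comp_apply, Function.Embedding.coeFn_mk]
    have := congrArg (fun S => S.val.map fun q : Σ t, Fin (s t) => 2 * n q.1 q.2) (hfil t)
    simp only [Finset.map_val, Multiset.map_map] at this
    refine Eq.trans ?_ this
    congr!
  · simp [algTypeOfBlocks, trivialKroneckerType]

/-! ### Truncated polynomials -/

/-- The truncated polynomial algebra `ℂ[y] / (y ^ N)`. -/
abbrev Trunc (N : ℕ) : Type :=
  PowerSeries ℂ ⧸ Ideal.span {(PowerSeries.X : PowerSeries ℂ) ^ N}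

namespace Trunc

/-- The projection from power series. -/
abbrev mk (N : ℕ) : PowerSeries ℂ →ₐ[ℂ] Trunc N := Ideal.Quotient.mkₐ ℂ _

lemma mk_surjective (N : ℕ) : Function.Surjective (mk N) := Ideal.Quotient.mkₐ_surjective ℂ _

lemma mk_eq_mk_iff {N : ℕ} {p q : PowerSeries ℂ} :
    mk N p = mk N q ↔ ∀ k < N, PowerSeries.coeff k p = PowerSeries.coeff k q := by
  rw [Ideal.Quotient.mkₐ_eq_mk, Ideal.Quotient.eq, Ideal.mem_span_singleton,
    PowerSeries.X_pow_dvd_iff]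
  simp [sub_eq_zero]

lemma mk_out {N : ℕ} (q : Trunc N) : mk N (Quotient.out q) = q := Quotient.out_eq q

/-- The `k`-th coefficient of a truncated polynomial (`0` if `N ≤ k`). -/
def coeff (N k : ℕ) : Trunc N →ₗ[ℂ] ℂ where
  -- Below `N` the coefficient is independent of the representative; from `N` on it is not, and the
  -- default `0` keeps the map linear.
  toFun q := if k < N then PowerSeries.coeff k (Quotient.out q : PowerSeries ℂ) else 0
  map_add' a b := by
    split_ifs with h
    · rw [← map_add]
      exact mk_eq_mk_iff.mp (by rw [map_add, mk_out, mk_out, mk_out]) k h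
    · simp
  map_smul' c a := by
    split_ifs with h
    · rw [RingHom.id_apply, ← map_smul]
      exact mk_eq_mk_iff.mp (by rw [map_smul, mk_out, mk_out]) k h
    · simp

lemma coeff_mk {N k : ℕ} (h : k < N) (p : PowerSeries ℂ) :
    coeff N k (mk N p) = PowerSeries.coeff k p := by
  change (if k < N then PowerSeries.coeff k (Quotient.out (mk N p) : PowerSeries ℂ) else 0) = _
  rw [if_pos h]
  exact mk_eq_mk_iff.mp (mk_out _) k h

lemma ext_coeff {N : ℕ} {a b : Trunc N} (h : ∀ k < N, coeff N k a = coeff N k b) : a = b := by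
  obtain ⟨p, rfl⟩ := mk_surjective N a
  obtain ⟨q, rfl⟩ := mk_surjective N b
  exact mk_eq_mk_iff.mpr fun k hk => by rw [← coeff_mk hk, h k hk, coeff_mk hk]

lemma coeff_zero_mul {N : ℕ} (hN : 0 < N) (a b : Trunc N) :
    coeff N 0 (a * b) = coeff N 0 a * coeff N 0 b := by
  obtain ⟨p, rfl⟩ := mk_surjective N a
  obtain ⟨q, rfl⟩ := mk_surjective N b
  rw [← map_mul, coeff_mk hN, coeff_mk hN, coeff_mk hN]
  simp

lemma coeff_zero_algebraMap {N : ℕ} (hN : 0 < N) (c : ℂ) :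
    coeff N 0 (algebraMap ℂ (Trunc N) c) = c := by
  rw [← (mk N).commutes, coeff_mk hN]
  simp

lemma coeff_zero_one {N : ℕ} (hN : 0 < N) : coeff N 0 1 = 1 := by
  rw [← map_one (mk N), coeff_mk hN]
  simp

lemma coeff_algebraMap {N k : ℕ} (hk : k < N) (h0 : k ≠ 0) (c : ℂ) :
    coeff N k (algebraMap ℂ (Trunc N) c) = 0 := by
  rw [← (mk N).commutes, coeff_mk hk]
  simp [PowerSeries.coeff_C, h0]

lemma coeff_mk_X_pow {N k d : ℕ} (hk : k < N) :
    coeff N k (mk N (PowerSeries.X ^ d)) = if k = d then 1 else 0 := by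
  rw [coeff_mk hk, PowerSeries.coeff_X_pow]

lemma coeff_mul_X_pow {N j : ℕ} (hj : j < N) (a : Trunc N) (d : ℕ) :
    coeff N j (a * mk N (PowerSeries.X ^ d)) = if d ≤ j then coeff N (j - d) a else 0 := by
  obtain ⟨p, rfl⟩ := mk_surjective N a
  rw [← map_mul, coeff_mk hj, PowerSeries.coeff_mul_X_pow']
  split_ifs
  · rw [coeff_mk (by omega)]
  · rfl

lemma mk_X_pow_mul_eq_zero {N d : ℕ} (h : N ≤ d) (p : PowerSeries ℂ) :
    mk N (PowerSeries.X ^ d * p) = 0 := by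
  rw [Ideal.Quotient.mkₐ_eq_mk, Ideal.Quotient.eq_zero_iff_mem, Ideal.mem_span_singleton]
  exact Dvd.dvd.mul_right (pow_dvd_pow _ h) _

lemma exists_eq_X_mul {N : ℕ} (hN : 0 < N) {η : Trunc N} (h : coeff N 0 η = 0) :
    ∃ P : PowerSeries ℂ, η = mk N (PowerSeries.X * P) ∧
      (1 < N → PowerSeries.constantCoeff P = coeff N 1 η) := by
  obtain ⟨p, rfl⟩ := mk_surjective N η
  rw [coeff_mk hN, PowerSeries.coeff_zero_eq_constantCoeff_apply, ← PowerSeries.X_dvd_iff] at h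
  obtain ⟨P, rfl⟩ := h
  refine ⟨P, rfl, fun h1 => ?_⟩
  rw [coeff_mk h1]
  exact (PowerSeries.coeff_zero_eq_constantCoeff_apply P).symm.trans
    (PowerSeries.coeff_succ_X_mul 0 P).symm

/-- `η` is divisible by `y`, so the product is divisible by `y ^ (m + d)`. This bounds the length of
a chain from above. -/
lemma pow_mul_X_pow_eq_zero {N m d : ℕ} (hN : 0 < N) {η : Trunc N} (h : coeff N 0 η = 0)
    (hmd : N ≤ m + d) : η ^ m * mk N (PowerSeries.X ^ d) = 0 := by
  obtain ⟨P, rfl, -⟩ := exists_eq_X_mul hN h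
  rw [← map_pow, ← map_mul, mul_pow, mul_right_comm, ← pow_add]
  exact mk_X_pow_mul_eq_zero hmd _

/-- Writing `η = y * P`, the product is `y ^ (m + d) * P ^ m`, whose leading coefficient is `P(0) ^
m`. It shows that a chain does not end too early. -/
lemma coeff_pow_mul_X_pow {N m d : ℕ} {η : Trunc N} (h : coeff N 0 η = 0)
    (hmd : m + d < N) (hN : m ≠ 0 → 1 < N) :
    coeff N (m + d) (η ^ m * mk N (PowerSeries.X ^ d)) = coeff N 1 η ^ m := by
  obtain ⟨P, hP, h1⟩ := exists_eq_X_mul (by omega) h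
  rw [hP, ← map_pow, ← map_mul, mul_pow, mul_right_comm, ← pow_add, coeff_mk hmd]
  have := PowerSeries.coeff_X_pow_mul (P ^ m) (m + d) 0
  rw [zero_add] at this
  rw [this, ← hP]
  rcases eq_or_ne m 0 with rfl | hm
  · simp
  · rw [← h1 (hN hm)]
    simp

lemma coeff_one_mul {N : ℕ} (hN : 1 < N) (a b : Trunc N) (h : coeff N 0 b = 0) :
    coeff N 1 (a * b) = coeff N 0 a * coeff N 1 b := by
  obtain ⟨P, rfl, h1⟩ := exists_eq_X_mul (by omega) h
  obtain ⟨p, rfl⟩ := mk_surjective N a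
  rw [← h1 hN, ← map_mul, coeff_mk hN, coeff_mk (by omega), mul_left_comm]
  have := PowerSeries.coeff_succ_X_mul 0 (p * P)
  rw [zero_add] at this
  rw [this]
  simp

lemma exists_mul_eq_one {N : ℕ} (hN : 0 < N) (a : Trunc N) (h : coeff N 0 a ≠ 0) :
    ∃ u : Trunc N, a * u = 1 := by
  obtain ⟨p, rfl⟩ := mk_surjective N a
  rw [coeff_mk hN, PowerSeries.coeff_zero_eq_constantCoeff_apply] at h
  exact ⟨mk N p⁻¹, by rw [← map_mul, PowerSeries.mul_inv_cancel p h, map_one]⟩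

end Trunc

/-! ### The algebra, the ideal and the chains attached to Jordan tuples -/

/-- Jordan tuples, some of which are assigned an index at which the maximum is attained and is
attained only once. -/
structure TupleData where
  p : ℕ
  s : Fin p → ℕ
  n : (t : Fin p) → Fin (s t) → ℕ
  main : (t : Fin p) → Option (Fin (s t))
  s_pos : ∀ t, 0 < s t
  n_pos : ∀ t i, 0 < n t i
  lt_main : ∀ t i j, main t = some i → j ≠ i → n t j < n t i

namespace TupleData

variable (D : TupleData)

/-- The indices of the Jordan blocks. -/
abbrev Idx : Type := Σ t, Fin (D.s t)

/-- Half the size of a Jordan block. -/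
def len (κ : D.Idx) : ℕ := D.n κ.1 κ.2

/-- `0` for the distinguished blocks, `1` for all others. -/
def shift (κ : D.Idx) : ℕ := if D.main κ.1 = some κ.2 then 0 else 1

lemma len_pos (κ : D.Idx) : 0 < D.len κ := D.n_pos _ _

/-- The order of truncation in the component of a block. -/
def order (κ : D.Idx) : ℕ := D.len κ + D.shift κ

lemma order_pos (κ : D.Idx) : 0 < D.order κ := Nat.add_pos_left (D.len_pos κ) _

/-- Families of truncated polynomials with equal constant terms inside each tuple. -/
def subalgebra : Subalgebra ℂ ((κ : D.Idx) → Trunc (D.order κ)) where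
  carrier := {q | ∀ t i j, Trunc.coeff _ 0 (q ⟨t, i⟩) = Trunc.coeff _ 0 (q ⟨t, j⟩)}
  mul_mem' {a b} ha hb t i j := by
    simp only [Pi.mul_apply, Trunc.coeff_zero_mul (D.order_pos _)]
    rw [ha t i j, hb t i j]
  add_mem' {a b} ha hb t i j := by
    simp only [Pi.add_apply, map_add]
    rw [ha t i j, hb t i j]
  algebraMap_mem' c t i j := by
    simp only [Pi.algebraMap_apply, Trunc.coeff_zero_algebraMap (D.order_pos _)]

/-- Families of truncated polynomials with equal constant terms inside each tuple, as a type. -/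
def Alg : Type := D.subalgebra

instance : CommRing D.Alg := inferInstanceAs (CommRing D.subalgebra)

instance : Algebra ℂ D.Alg := inferInstanceAs (Algebra ℂ D.subalgebra)

/-- The component of an element of the algebra. -/
def comp (κ : D.Idx) : D.Alg →ₐ[ℂ] Trunc (D.order κ) :=
  (Pi.evalAlgHom ℂ _ κ).comp D.subalgebra.val

/-- The common constant term in a tuple. -/
def const (t : Fin D.p) : D.Alg →ₗ[ℂ] ℂ :=
  Trunc.coeff _ 0 ∘ₗ (D.comp ⟨t, ⟨0, D.s_pos t⟩⟩).toLinearMap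

lemma coeff_zero_comp (κ : D.Idx) (q : D.Alg) :
    Trunc.coeff _ 0 (D.comp κ q) = D.const κ.1 q := Subtype.property q _ _ _

variable {D} in
lemma Alg.ext {a b : D.Alg} (h : ∀ κ, D.comp κ a = D.comp κ b) : a = b :=
  Subtype.ext (funext h)

lemma const_mul (t : Fin D.p) (a b : D.Alg) : D.const t (a * b) = D.const t a * D.const t b := by
  simp [← D.coeff_zero_comp ⟨t, ⟨0, D.s_pos t⟩⟩, Trunc.coeff_zero_mul (D.order_pos _)]

/-- The ideal of elements without constant terms in the tuples without a distinguished block. -/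
def ideal : Ideal D.Alg where
  carrier := {q | ∀ t, D.main t = none → D.const t q = 0}
  add_mem' {a b} ha hb t ht := by rw [map_add, ha t ht, hb t ht, add_zero]
  zero_mem' t _ := map_zero _
  smul_mem' c a ha t ht := by rw [smul_eq_mul, const_mul, ha t ht, mul_zero]

/-- The scalars `c t l` in the components of the tuple `t`. -/
def scalars {r : ℕ} (c : Fin D.p → Fin r → ℂ) (l : Fin r) : D.Alg :=
  ⟨fun κ => algebraMap ℂ _ (c κ.1 l), fun t i j => by
    simp only [Trunc.coeff_zero_algebraMap (D.order_pos _)]⟩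

lemma comp_scalars {r : ℕ} (c : Fin D.p → Fin r → ℂ) (l : Fin r) (κ : D.Idx) :
    D.comp κ (D.scalars c l) = algebraMap ℂ _ (c κ.1 l) := rfl

/-- Coordinates on the ideal. -/
def coord : D.ideal →ₗ[ℂ] (Σ κ : D.Idx, Fin (D.len κ)) → ℂ :=
  LinearMap.pi fun q => Trunc.coeff _ (q.2.val + D.shift q.1) ∘ₗ (D.comp q.1).toLinearMap ∘ₗ
    D.ideal.subtype.restrictScalars ℂ

lemma coord_apply (w : D.ideal) (q : Σ κ : D.Idx, Fin (D.len κ)) :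
    D.coord w q = Trunc.coeff _ (q.2.val + D.shift q.1) (D.comp q.1 w) := rfl

/-- The only coefficient of a component omitted by the coordinates is the constant term of an
ordinary block. It vanishes if the tuple has no distinguished block, and otherwise equals the one
recorded on that block. -/
lemma coord_injective : Function.Injective D.coord := by
  rw [← LinearMap.ker_eq_bot, LinearMap.ker_eq_bot']
  intro w hw
  have hc : ∀ κ k (h : k < D.len κ), Trunc.coeff _ (k + D.shift κ) (D.comp κ w) = 0 :=
    fun κ k h => congrFun hw ⟨κ, ⟨k, h⟩⟩
  refine Subtype.ext (Alg.ext fun κ => Trunc.ext_coeff fun k hk => ?_)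
  rw [ZeroMemClass.coe_zero, map_zero, map_zero]
  unfold order at hk
  by_cases hks : D.shift κ ≤ k
  · have := hc κ (k - D.shift κ) (by omega)
    rwa [Nat.sub_add_cancel hks] at this
  · have hk0 : k = 0 := by
      unfold shift at hks
      split_ifs at hks <;> omega
    rw [hk0, coeff_zero_comp]
    rcases hm : D.main κ.1 with _ | i
    · exact w.2 _ hm
    · have := hc ⟨κ.1, i⟩ 0 (D.len_pos _)
      have hs : D.shift ⟨κ.1, i⟩ = 0 := if_pos hm
      rwa [hs, coeff_zero_comp] at this

instance : FiniteDimensional ℂ D.ideal :=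
  Module.Finite.of_injective D.coord D.coord_injective

/-- An upper bound suffices: independent chains of total length `∑ κ, D.len κ` then fill the ideal.
-/
lemma finrank_ideal_le : Module.finrank ℂ D.ideal ≤ ∑ κ, D.len κ := by
  simpa using LinearMap.finrank_le_finrank_of_injective D.coord_injective

/-- The monomial `y ^ (d + 1)` in the component `κ`. -/
def mono (κ : D.Idx) (d : ℕ) : D.ideal :=
  have hc : ∀ κ', Trunc.coeff _ 0 ((Pi.single κ (Trunc.mk _ (PowerSeries.X ^ (d + 1))) :
      (κ : D.Idx) → Trunc (D.order κ)) κ') = 0 := fun κ' => by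
    by_cases h' : κ' = κ
    · subst h'
      rw [Pi.single_eq_same, Trunc.coeff_mk_X_pow (D.order_pos _), if_neg (by omega)]
    · rw [Pi.single_eq_of_ne h', map_zero]
  ⟨⟨Pi.single κ (Trunc.mk _ (PowerSeries.X ^ (d + 1))), fun t i j => by rw [hc, hc]⟩,
    fun t _ => hc _⟩

lemma comp_mono_self (κ : D.Idx) (d : ℕ) :
    D.comp κ (D.mono κ d) = Trunc.mk _ (PowerSeries.X ^ (d + 1)) := Pi.single_eq_same _ _

lemma comp_mono_of_ne {κ κ' : D.Idx} (hne : κ' ≠ κ) (d : ℕ) : D.comp κ' (D.mono κ d) = 0 :=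
  Pi.single_eq_of_ne hne _

/-- The generators of the Jordan chains. -/
def top (κ : D.Idx) : D.ideal :=
  -- A distinguished block starts from the idempotent of its whole tuple, since the constant terms
  -- of a tuple must agree; any other block starts from `y` in its own component.
  if h : D.main κ.1 = some κ.2 then
    ⟨⟨fun κ' => if κ'.1 = κ.1 then 1 else 0, fun t i j => by
      by_cases ht : t = κ.1
      · simp only [ht, if_true]
        rw [Trunc.coeff_zero_one (D.order_pos _), Trunc.coeff_zero_one (D.order_pos _)]
      · simp [ht]⟩, fun t ht => by
      have : t ≠ κ.1 := fun h' => by rw [h', h] at ht; cases ht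
      change Trunc.coeff _ 0 (if t = κ.1 then 1 else 0) = 0
      simp [this]⟩
  else D.mono κ 0

lemma comp_top_main {κ : D.Idx} (h : D.main κ.1 = some κ.2) (κ' : D.Idx) :
    D.comp κ' (D.top κ) = if κ'.1 = κ.1 then 1 else 0 := by
  rw [top, dif_pos h]
  rfl

lemma comp_top_of_ne {κ κ' : D.Idx} (h : D.main κ.1 ≠ some κ.2) (hne : κ' ≠ κ) :
    D.comp κ' (D.top κ) = 0 := by
  rw [top, dif_neg h, comp_mono_of_ne D hne]

lemma comp_top_self (κ : D.Idx) :
    D.comp κ (D.top κ) = Trunc.mk _ (PowerSeries.X ^ D.shift κ) := by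
  by_cases h : D.main κ.1 = some κ.2
  · rw [comp_top_main D h, if_pos rfl, shift, if_pos h, pow_zero, map_one]
  · rw [shift, if_neg h, top, dif_neg h, comp_mono_self]

/-- Inverting componentwise stays in the subalgebra: the constant terms of the inverses are the
inverses of the common constant terms. -/
lemma exists_mul_eq_one (a : D.Alg) (h : ∀ t, D.const t a ≠ 0) : ∃ u : D.Alg, a * u = 1 := by
  have hex : ∀ κ, ∃ u, D.comp κ a * u = 1 := fun κ =>
    Trunc.exists_mul_eq_one (D.order_pos κ) _ (by rw [coeff_zero_comp]; exact h κ.1)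
  choose u hu using hex
  have hu0 : ∀ κ, D.const κ.1 a * Trunc.coeff _ 0 (u κ) = 1 := fun κ => by
    rw [← coeff_zero_comp, ← Trunc.coeff_zero_mul (D.order_pos κ), hu,
      Trunc.coeff_zero_one (D.order_pos κ)]
  exact ⟨⟨u, fun t i j => mul_left_cancel₀ (h t) ((hu0 ⟨t, i⟩).trans (hu0 ⟨t, j⟩).symm)⟩,
    Alg.ext hu⟩

/-- Powers of an element `δ` without constant terms annihilate the generators. -/
lemma pow_len_smul_top (κ : D.Idx) (δ : D.Alg) (hδ : D.const κ.1 δ = 0) :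
    δ ^ D.len κ • D.top κ = 0 := by
  refine Subtype.ext (Alg.ext fun κ' => ?_)
  change D.comp κ' (δ ^ D.len κ * D.top κ) = D.comp κ' 0
  rw [map_mul, map_pow, map_zero]
  by_cases hκ : κ' = κ
  · subst hκ
    rw [comp_top_self]
    exact Trunc.pow_mul_X_pow_eq_zero (D.order_pos _) (by rw [coeff_zero_comp, hδ]) le_rfl
  · by_cases h : D.main κ.1 = some κ.2
    · rw [comp_top_main D h]
      split_ifs with ht
      · rcases κ with ⟨t, i⟩
        rcases κ' with ⟨t', j⟩
        obtain rfl : t' = t := ht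
        have hj : j ≠ i := fun hj => hκ (by rw [hj])
        have hlt : D.len ⟨t', j⟩ < D.len ⟨t', i⟩ := D.lt_main t' i j h hj
        have hs : D.shift ⟨t', j⟩ ≤ 1 := by
          unfold shift
          split_ifs <;> omega
        -- Strict maximality enters: the component `j` is truncated at order at most `len j + 1 ≤
        -- len i`.
        have := Trunc.pow_mul_X_pow_eq_zero (m := D.len ⟨t', i⟩) (d := 0) (D.order_pos ⟨t', j⟩)
          (η := D.comp ⟨t', j⟩ δ) (by rw [coeff_zero_comp, hδ]) (by unfold order; omega)
        simpa using this
      · rw [mul_zero]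
    · rw [comp_top_of_ne D h hκ, mul_zero]

/-- The ends of the Jordan chains are linearly independent. -/
lemma linearIndependent_pow_smul_top (δ : D.Idx → D.Alg) (hδ : ∀ κ, D.const κ.1 (δ κ) = 0)
    (hδ1 : ∀ κ, 2 ≤ D.len κ → Trunc.coeff _ 1 (D.comp κ (δ κ)) ≠ 0) :
    LinearIndependent ℂ fun κ => δ κ ^ (D.len κ - 1) • D.top κ := by
  classical
  rw [Fintype.linearIndependent_iff]
  intro c hc
  have hcomp : ∀ κ', ∑ κ, c κ • (D.comp κ' (δ κ) ^ (D.len κ - 1) * D.comp κ' (D.top κ)) = 0 := by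
    intro κ'
    have := congrArg (fun w : D.ideal => D.comp κ' (w : D.Alg)) hc
    simpa [Submodule.coe_sum] using this
  have hself : ∀ κ, D.comp κ (δ κ) ^ (D.len κ - 1) * D.comp κ (D.top κ) ≠ 0 := by
    intro κ h0
    have hlen := D.len_pos κ
    have := Trunc.coeff_pow_mul_X_pow (N := D.order κ) (m := D.len κ - 1) (d := D.shift κ)
      (η := D.comp κ (δ κ)) (by rw [coeff_zero_comp, hδ]) (by unfold order; omega)
      (by unfold order; omega)
    rw [← comp_top_self, h0, map_zero] at this
    by_cases h2 : 2 ≤ D.len κ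
    · exact pow_ne_zero _ (hδ1 κ h2) this.symm
    · rw [show D.len κ - 1 = 0 by omega, pow_zero] at this
      exact zero_ne_one this
  -- The system is triangular: in the component `κ'` only its own chain and that of the
  -- distinguished block of the tuple can be nonzero. Distinguished coefficients therefore vanish
  -- first, then all others.
  have hstep : ∀ κ', (∀ κ, κ ≠ κ' → D.main κ.1 = some κ.2 → κ'.1 = κ.1 → c κ = 0) → c κ' = 0 := by
    intro κ' h
    have := hcomp κ'
    rw [Finset.sum_eq_single_of_mem κ' (Finset.mem_univ _)] at this
    · exact (smul_eq_zero.mp this).resolve_right (hself κ')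
    · intro κ _ hne
      by_cases hm : D.main κ.1 = some κ.2
      · by_cases ht : κ'.1 = κ.1
        · rw [h κ hne hm ht, zero_smul]
        · rw [comp_top_main D hm, if_neg ht, mul_zero, smul_zero]
      · rw [comp_top_of_ne D hm hne.symm, mul_zero, smul_zero]
  have hmain : ∀ κ, D.main κ.1 = some κ.2 → c κ = 0 := by
    rintro ⟨t, i⟩ hm
    refine hstep _ ?_
    rintro ⟨t', j⟩ hne hm' ht
    obtain rfl : t = t' := ht
    obtain rfl : i = j := Option.some.inj (hm.symm.trans hm')
    exact absurd rfl hne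
  exact fun κ => hstep κ fun κ'' _ hm _ => hmain κ'' hm

/-! ### Generic parameters and the invariants -/

section
variable {r : ℕ} (c : Fin D.p → Fin r → ℂ)

/-- The eigenvalue of a parameter on a tuple. -/
def eigen (t : Fin D.p) : Module.Dual ℂ (Param D.ideal r) :=
  D.const t ∘ₗ paramElt D.ideal (D.scalars c)

/-- The linear coefficient of a parameter on a block. -/
def slope (κ : D.Idx) : Module.Dual ℂ (Param D.ideal r) :=
  Trunc.coeff _ 1 ∘ₗ (D.comp κ).toLinearMap ∘ₗ paramElt D.ideal (D.scalars c)

/-- Sufficient genericity of a pair of parameters. -/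
structure IsGeneric (ξ α : Param D.ideal r) : Prop where
  eigen_ne : ∀ t, D.eigen c t α ≠ 0
  eigen_sep : ∀ t t', t ≠ t' →
    D.eigen c t ξ * D.eigen c t' α - D.eigen c t' ξ * D.eigen c t α ≠ 0
  -- This is the numerator of the linear coefficient of `ξ/α`; chains of length one do not need it.
  slope_ne : ∀ κ, 2 ≤ D.len κ →
    D.eigen c κ.1 α * D.slope c κ ξ - D.eigen c κ.1 ξ * D.slope c κ α ≠ 0

/-- With `u` the inverse of `α`, one has `ξ/α - μ = u * (ξ - μ α)`. Genericity makes `ξ - μ α` free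
of constant term, with nonzero linear coefficient on every block of half-size at least two, and
multiplication by the unit `u` preserves both properties. -/
theorem hasAlgType_of_isGeneric {ξ α : Param D.ideal r} (hg : D.IsGeneric c ξ α)
    (x a : Module.Dual ℂ (SemidirectAlg D.ideal (D.scalars c)))
    (hx : ∀ φ : Module.Dual ℂ (Param D.ideal r),
      x ((0, φ) : D.ideal × Module.Dual ℂ (Param D.ideal r)) = φ ξ)
    (ha : ∀ φ : Module.Dual ℂ (Param D.ideal r),
      a ((0, φ) : D.ideal × Module.Dual ℂ (Param D.ideal r)) = φ α) :
    HasAlgType (lieForm x) (lieForm a) (trivialKroneckerType D.n r) := by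
  obtain ⟨u, hu⟩ := D.exists_mul_eq_one (paramElt D.ideal (D.scalars c) α) hg.eigen_ne
  set μ : Fin D.p → ℂ := fun t => D.eigen c t ξ / D.eigen c t α with hμ
  have hμinj : Function.Injective μ := by
    intro t t' h
    by_contra hne
    apply hg.eigen_sep t t' hne
    rw [hμ] at h
    simp only at h
    rw [div_eq_div_iff (hg.eigen_ne t) (hg.eigen_ne t')] at h
    rw [h, sub_self]
  set η : D.Idx → D.Alg := fun κ =>
    paramElt D.ideal (D.scalars c) ξ - μ κ.1 • paramElt D.ideal (D.scalars c) α with hη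
  have hδη : ∀ κ, u * paramElt D.ideal (D.scalars c) ξ - algebraMap ℂ _ (μ κ.1) = u * η κ := by
    intro κ
    rw [hη]
    simp only
    rw [mul_sub, mul_smul_comm, mul_comm u (paramElt D.ideal (D.scalars c) α), hu,
      Algebra.algebraMap_eq_smul_one]
  have hη0 : ∀ κ, D.const κ.1 (η κ) = 0 := by
    intro κ
    rw [hη]
    simp only [map_sub, map_smul]
    change D.eigen c κ.1 ξ - μ κ.1 • D.eigen c κ.1 α = 0
    rw [smul_eq_mul, div_mul_cancel₀ _ (hg.eigen_ne _), sub_self]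
  have hη1 : ∀ κ, 2 ≤ D.len κ → Trunc.coeff _ 1 (D.comp κ (η κ)) ≠ 0 := by
    intro κ hκ h0
    apply hg.slope_ne κ hκ
    rw [hη] at h0
    simp only [map_sub, map_smul] at h0
    change D.slope c κ ξ - μ κ.1 • D.slope c κ α = 0 at h0
    rw [sub_eq_zero.mp h0, smul_eq_mul, hμ]
    have := hg.eigen_ne κ.1
    field_simp
    ring
  have hu0 : ∀ t, D.const t u ≠ 0 := by
    intro t h0
    have h1 := congrArg (D.const t) hu
    rw [const_mul, h0, mul_zero, ← D.coeff_zero_comp ⟨t, ⟨0, D.s_pos t⟩⟩, map_one,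
      Trunc.coeff_zero_one (D.order_pos _)] at h1
    exact zero_ne_one h1
  have hδ0 : ∀ κ, D.const κ.1 (u * η κ) = 0 := fun κ => by rw [const_mul, hη0, mul_zero]
  rw [← algTypeOfBlocks_sigma D.s_pos D.n r μ hμinj]
  refine hasAlgType_of_jordan_chains x a ξ α hx ha u hu D.len D.len_pos (fun κ => μ κ.1) D.top
    ?_ ?_ D.finrank_ideal_le
  · intro κ
    rw [hδη]
    exact D.pow_len_smul_top κ _ (hδ0 κ)
  · simp only [hδη]
    refine D.linearIndependent_pow_smul_top _ hδ0 fun κ hκ => ?_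
    rw [map_mul, Trunc.coeff_one_mul (by unfold order; omega) _ _
      (by rw [coeff_zero_comp, hη0]), coeff_zero_comp]
    exact mul_ne_zero (hu0 _) (hη1 κ hκ)

/-- The parameter of a functional on the semidirect product. -/
lemma exists_param (x : Module.Dual ℂ (SemidirectAlg D.ideal (D.scalars c))) :
    ∃ ξ : Param D.ideal r, ∀ φ : Module.Dual ℂ (Param D.ideal r),
      x ((0, φ) : D.ideal × Module.Dual ℂ (Param D.ideal r)) = φ ξ := by
  set y : Module.Dual ℂ (Module.Dual ℂ (Param D.ideal r)) :=
    (x : (D.ideal × Module.Dual ℂ (Param D.ideal r)) →ₗ[ℂ] ℂ) ∘ₗ LinearMap.inr ℂ _ _ with hy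
  refine ⟨(Module.evalEquiv ℂ (Param D.ideal r)).symm y, fun φ => ?_⟩
  rw [Module.apply_evalEquiv_symm_apply]
  rfl

/-- The genericity conditions as polynomials on pairs of functionals. -/
def genericPoly : Fin D.p ⊕ (Fin D.p × Fin D.p) ⊕ D.Idx →
    MvPolynomial (Module.Dual ℂ (Module.Dual ℂ (SemidirectAlg D.ideal (D.scalars c)) ×
      Module.Dual ℂ (SemidirectAlg D.ideal (D.scalars c)))) ℂ :=
  let ev (φ : Module.Dual ℂ (Param D.ideal r)) :=
    Module.Dual.eval ℂ (SemidirectAlg D.ideal (D.scalars c))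
      ((0, φ) : D.ideal × Module.Dual ℂ (Param D.ideal r))
  let X₁ φ := MvPolynomial.X (ev φ ∘ₗ LinearMap.fst ℂ _ _)
  let X₂ φ := MvPolynomial.X (ev φ ∘ₗ LinearMap.snd ℂ _ _)
  Sum.elim (fun t => X₂ (D.eigen c t)) (Sum.elim
    -- The constant `1` fills the index pairs and blocks that carry no condition.
    (fun t => if t.1 = t.2 then 1 else
      X₁ (D.eigen c t.1) * X₂ (D.eigen c t.2) - X₁ (D.eigen c t.2) * X₂ (D.eigen c t.1))
    (fun κ => if 2 ≤ D.len κ then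
      X₂ (D.eigen c κ.1) * X₁ (D.slope c κ) - X₁ (D.eigen c κ.1) * X₂ (D.slope c κ) else 1))

lemma genericPoly_ne_zero_iff {ξ α : Param D.ideal r}
    (x a : Module.Dual ℂ (SemidirectAlg D.ideal (D.scalars c)))
    (hx : ∀ φ : Module.Dual ℂ (Param D.ideal r),
      x ((0, φ) : D.ideal × Module.Dual ℂ (Param D.ideal r)) = φ ξ)
    (ha : ∀ φ : Module.Dual ℂ (Param D.ideal r),
      a ((0, φ) : D.ideal × Module.Dual ℂ (Param D.ideal r)) = φ α) :
    (∀ i, MvPolynomial.eval (fun φ => φ (x, a)) (D.genericPoly c i) ≠ 0) ↔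
      D.IsGeneric c ξ α := by
  have hx' : ∀ φ : Module.Dual ℂ (Param D.ideal r),
      Module.Dual.eval ℂ (SemidirectAlg D.ideal (D.scalars c))
        ((0, φ) : D.ideal × Module.Dual ℂ (Param D.ideal r)) x = φ ξ := hx
  have ha' : ∀ φ : Module.Dual ℂ (Param D.ideal r),
      Module.Dual.eval ℂ (SemidirectAlg D.ideal (D.scalars c))
        ((0, φ) : D.ideal × Module.Dual ℂ (Param D.ideal r)) a = φ α := ha
  have h1 : ∀ t, MvPolynomial.eval (fun φ => φ (x, a)) (D.genericPoly c (Sum.inl t)) =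
      D.eigen c t α := fun t => by simp [genericPoly, ha']
  have h2 : ∀ t t', t ≠ t' → MvPolynomial.eval (fun φ => φ (x, a))
      (D.genericPoly c (Sum.inr (Sum.inl (t, t')))) =
      D.eigen c t ξ * D.eigen c t' α - D.eigen c t' ξ * D.eigen c t α := fun t t' h => by
    simp [genericPoly, ha', hx', h]
  have h3 : ∀ κ, 2 ≤ D.len κ → MvPolynomial.eval (fun φ => φ (x, a))
      (D.genericPoly c (Sum.inr (Sum.inr κ))) =
      D.eigen c κ.1 α * D.slope c κ ξ - D.eigen c κ.1 ξ * D.slope c κ α := fun κ h => by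
    simp [genericPoly, ha', hx', h]
  constructor
  · exact fun h => ⟨fun t => h1 t ▸ h _, fun t t' hne => h2 t t' hne ▸ h _,
      fun κ hκ => h3 κ hκ ▸ h _⟩
  · rintro ⟨g1, g2, g3⟩ (t | ⟨t, t'⟩ | κ)
    · exact h1 t ▸ g1 t
    · by_cases hne : t = t'
      · simp [genericPoly, hne]
      · exact h2 t t' hne ▸ g2 t t' hne
    · by_cases hκ : 2 ≤ D.len κ
      · exact h3 κ hκ ▸ g3 κ hκ
      · simp [genericPoly, hκ]

theorem hasJKInvariants (h : ∃ ξ α, D.IsGeneric c ξ α) :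
    HasJKInvariants (SemidirectAlg D.ideal (D.scalars c)) (trivialKroneckerType D.n r) := by
  refine ⟨_, isZariskiOpen_of_forall_ne_zero (D.genericPoly c), ?_, ?_⟩
  · obtain ⟨ξ, α, hg⟩ := h
    have hex : ∀ ξ : Param D.ideal r, ∃ x : Module.Dual ℂ (SemidirectAlg D.ideal (D.scalars c)),
        ∀ φ : Module.Dual ℂ (Param D.ideal r),
          x ((0, φ) : D.ideal × Module.Dual ℂ (Param D.ideal r)) = φ ξ := fun ξ =>
      ⟨(Module.Dual.eval ℂ _ ξ ∘ₗ LinearMap.snd ℂ D.ideal (Module.Dual ℂ (Param D.ideal r)) :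
        (D.ideal × Module.Dual ℂ (Param D.ideal r)) →ₗ[ℂ] ℂ), fun φ => rfl⟩
    obtain ⟨x, hx⟩ := hex ξ
    obtain ⟨a, ha⟩ := hex α
    exact ⟨(x, a), (D.genericPoly_ne_zero_iff c x a hx ha).mpr hg⟩
  · rintro ⟨x, a⟩ hw
    obtain ⟨ξ, hx⟩ := D.exists_param c x
    obtain ⟨α, ha⟩ := D.exists_param c a
    exact D.hasAlgType_of_isGeneric c ((D.genericPoly_ne_zero_iff c x a hx ha).mp hw) x a hx ha

end

/-! ### Existence of generic parameters -/

variable {r : ℕ} (c : Fin D.p → Fin r → ℂ)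

/-- The element with constant terms `v t` and linear coefficients `a`. -/
def affine (v : Fin D.p → ℂ) (a : ℂ) : D.Alg :=
  ⟨fun κ => algebraMap ℂ _ (v κ.1) + a • Trunc.mk _ (PowerSeries.X ^ 1), fun t i j => by
    simp only [map_add, map_smul, Trunc.coeff_zero_algebraMap (D.order_pos _),
      Trunc.coeff_mk_X_pow (D.order_pos _)]⟩

lemma comp_affine (v : Fin D.p → ℂ) (a : ℂ) (κ : D.Idx) :
    D.comp κ (D.affine v a) =
      algebraMap ℂ _ (v κ.1) + a • Trunc.mk _ (PowerSeries.X ^ 1) := rfl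

lemma const_affine (v : Fin D.p → ℂ) (a : ℂ) (t : Fin D.p) : D.const t (D.affine v a) = v t := by
  rw [← D.coeff_zero_comp ⟨t, ⟨0, D.s_pos t⟩⟩, comp_affine, map_add, map_smul,
    Trunc.coeff_zero_algebraMap (D.order_pos _), Trunc.coeff_mk_X_pow (D.order_pos _)]
  simp

lemma paramElt_affine (v : Fin D.p → ℂ) (a : ℂ) (h : D.affine v a ∈ D.ideal) (e : Fin r → ℂ) :
    paramElt D.ideal (D.scalars c) (⟨D.affine v a, h⟩, e) =
      D.affine (fun t => v t + ∑ l, c t l * e l) a := by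
  refine Alg.ext fun κ => ?_
  rw [paramElt_apply, map_add, map_sum, comp_affine, comp_affine]
  simp only [comp_scalars, map_add, map_sum, Algebra.smul_def, map_mul]
  rw [add_right_comm]
  congr 2
  exact Finset.sum_congr rfl fun l _ => mul_comm _ _

/-- Here `α` is the unit element and `ξ` is `v t + y` on the tuple `t`, so the eigenvalues are the
distinct `v t` and all relevant slopes are `1`. -/
lemma isGeneric_of_affine {ξ α : Param D.ideal r} {v : Fin D.p → ℂ} (hv : Function.Injective v)
    (hξ : paramElt D.ideal (D.scalars c) ξ = D.affine v 1)
    (hα : paramElt D.ideal (D.scalars c) α = D.affine 1 0) : D.IsGeneric c ξ α := by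
  have hv' : ∀ t, D.eigen c t ξ = v t := fun t => by
    rw [eigen, LinearMap.comp_apply, hξ, const_affine]
  have h1 : ∀ t, D.eigen c t α = 1 := fun t => by
    rw [eigen, LinearMap.comp_apply, hα, const_affine, Pi.one_apply]
  refine ⟨fun t => by rw [h1]; exact one_ne_zero, fun t t' hne => ?_, fun κ hκ => ?_⟩
  · rw [hv', hv', h1, h1, mul_one, mul_one, sub_ne_zero]
    exact fun h => hne (hv h)
  · have hN : 1 < D.order κ := by unfold order; omega
    have hs : ∀ w a, Trunc.coeff _ 1 (D.comp κ (D.affine w a)) = a := fun w a => by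
      rw [comp_affine, map_add, map_smul, Trunc.coeff_algebraMap hN one_ne_zero,
        Trunc.coeff_mk_X_pow hN]
      simp
    have hsξ : D.slope c κ ξ = 1 := by
      rw [slope, LinearMap.comp_apply, LinearMap.comp_apply, hξ]
      exact hs _ _
    have hsα : D.slope c κ α = 0 := by
      rw [slope, LinearMap.comp_apply, LinearMap.comp_apply, hα]
      exact hs _ _
    rw [h1, hsξ, hsα]
    simp

lemma affine_mem_ideal {v : Fin D.p → ℂ} (hv : ∀ t, D.main t = none → v t = 0) (a : ℂ) :
    D.affine v a ∈ D.ideal := fun t ht => by rw [const_affine, hv t ht]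

/-- If at most one tuple has no distinguished block, one parameter suffices. -/
lemma exists_isGeneric_of_unique (h : ∀ t t', D.main t = none → D.main t' = none → t = t') :
    ∃ ξ α, D.IsGeneric (fun t (_ : Fin 1) => if D.main t = none then 1 else 0) ξ α := by
  -- The ideal supplies any constant terms on tuples with a distinguished block; on the remaining
  -- ones they must equal the single scalar `e`. Uniqueness of such a tuple lets `e` be its
  -- prescribed eigenvalue.
  have key : ∀ (v : Fin D.p → ℂ) (a e : ℂ), (∀ t, D.main t = none → e = v t) →
      ∃ ξ, paramElt D.ideal (D.scalars fun t (_ : Fin 1) => if D.main t = none then 1 else 0) ξ =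
        D.affine v a := by
    intro v a e he
    refine ⟨(⟨D.affine (fun t => if D.main t = none then 0 else v t) a,
      D.affine_mem_ideal (fun t ht => if_pos ht) a⟩, fun _ => e), ?_⟩
    rw [paramElt_affine]
    congr 1
    funext t
    by_cases ht : D.main t = none
    · simp [ht, he t ht]
    · simp [ht]
  obtain ⟨α, hα⟩ := key 1 0 1 fun _ _ => rfl
  obtain ⟨e, he⟩ : ∃ e : ℂ, ∀ t, D.main t = none → e = (t.val : ℂ) := by
    by_cases hex : ∃ t, D.main t = none
    · obtain ⟨t, ht⟩ := hex
      exact ⟨t.val, fun t' ht' => by rw [h t t' ht ht']⟩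
    · exact ⟨0, fun t ht => absurd ⟨t, ht⟩ hex⟩
  obtain ⟨ξ, hξ⟩ := key (fun t => (t.val : ℂ)) 1 e he
  exact ⟨ξ, α, D.isGeneric_of_affine _
    (fun t t' h => Fin.ext (Nat.cast_injective (R := ℂ) h)) hξ hα⟩

/-! ### The Heisenberg-type basis -/

variable {D}

lemma order_eq_of_none (hD : ∀ t, D.main t = none) (κ : D.Idx) : D.order κ = D.len κ + 1 := by
  simp [order, shift, hD]

lemma coord_eq_of_none (hD : ∀ t, D.main t = none) (w : D.ideal)
    (q : Σ κ : D.Idx, Fin (D.len κ)) :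
    D.coord w q = Trunc.coeff _ (q.2.val + 1) (D.comp q.1 w) := by
  simp [coord_apply, shift, hD]

lemma coord_mono (hD : ∀ t, D.main t = none) (q : Σ κ : D.Idx, Fin (D.len κ)) :
    D.coord (D.mono q.1 q.2) = Pi.single q 1 := by
  funext q'
  rw [coord_eq_of_none hD]
  obtain ⟨κ, k⟩ := q
  obtain ⟨κ', k'⟩ := q'
  by_cases h : κ' = κ
  · subst h
    rw [comp_mono_self, Trunc.coeff_mk_X_pow (by rw [order_eq_of_none hD]; omega)]
    simp [Pi.single_apply, Fin.ext_iff]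
  · rw [comp_mono_of_ne D h, map_zero, Pi.single_eq_of_ne]
    exact fun h' => h (congrArg Sigma.fst h')

/-- The ideal is isomorphic to its coordinate space if there are no distinguished blocks. -/
def coordEquiv (hD : ∀ t, D.main t = none) :
    D.ideal ≃ₗ[ℂ] ((Σ κ : D.Idx, Fin (D.len κ)) → ℂ) :=
  LinearEquiv.ofBijective D.coord ⟨D.coord_injective, fun v =>
    ⟨∑ q : Σ κ : D.Idx, Fin (D.len κ), v q • D.mono q.1 q.2, by
      simp only [map_sum, map_smul, coord_mono hD]
      exact (pi_eq_sum_univ' v).symm⟩⟩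

/-- The basis of monomials. -/
def monoBasis (hD : ∀ t, D.main t = none) :
    Module.Basis (Σ κ : D.Idx, Fin (D.len κ)) ℂ D.ideal :=
  Module.Basis.ofEquivFun (coordEquiv hD)

lemma monoBasis_apply (hD : ∀ t, D.main t = none) (q : Σ κ : D.Idx, Fin (D.len κ)) :
    monoBasis hD q = D.mono q.1 q.2 := by
  rw [monoBasis, Module.Basis.coe_ofEquivFun]
  exact (LinearEquiv.symm_apply_eq _).mpr (coord_mono hD q).symm

lemma monoBasis_repr (hD : ∀ t, D.main t = none) (w : D.ideal)
    (q : Σ κ : D.Idx, Fin (D.len κ)) :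
    (monoBasis hD).repr w q = Trunc.coeff _ (q.2.val + 1) (D.comp q.1 w) :=
  coord_eq_of_none hD w q

/-- The order in which the elements of the Heisenberg basis are listed. -/
def heisenbergEquiv (D : TupleData) (r : ℕ) :
    (Σ κ : D.Idx, Fin (D.len κ)) ⊕ ((Σ κ : D.Idx, Fin (D.len κ)) ⊕ Fin r) ≃
      Fin r ⊕ ((Σ t, Σ i : Fin (D.s t), Fin (D.n t i)) ⊕
        (Σ t, Σ i : Fin (D.s t), Fin (D.n t i))) where
  toFun
    | Sum.inl ⟨⟨t, i⟩, k⟩ => Sum.inr (Sum.inr ⟨t, i, k⟩)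
    | Sum.inr (Sum.inl ⟨⟨t, i⟩, k⟩) => Sum.inr (Sum.inl ⟨t, i, k⟩)
    | Sum.inr (Sum.inr l) => Sum.inl l
  invFun
    | Sum.inr (Sum.inr ⟨t, i, k⟩) => Sum.inl ⟨⟨t, i⟩, k⟩
    | Sum.inr (Sum.inl ⟨t, i, k⟩) => Sum.inr (Sum.inl ⟨⟨t, i⟩, k⟩)
    | Sum.inl l => Sum.inr (Sum.inr l)
  left_inv := by rintro (⟨⟨t, i⟩, k⟩ | ⟨⟨t, i⟩, k⟩ | l) <;> rfl
  right_inv := by rintro (l | ⟨t, i, k⟩ | ⟨t, i, k⟩) <;> rfl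

/-- The basis `h`, `e`, `f` of the semidirect product. -/
def heisenbergBasis (hD : ∀ t, D.main t = none) :
    Module.Basis (Fin r ⊕ ((Σ t, Σ i : Fin (D.s t), Fin (D.n t i)) ⊕
      (Σ t, Σ i : Fin (D.s t), Fin (D.n t i)))) ℂ (SemidirectAlg D.ideal (D.scalars c)) :=
  (((monoBasis hD).prod ((monoBasis hD).prod (Pi.basisFun ℂ (Fin r))).dualBasis).reindex
    (heisenbergEquiv D r) :
    Module.Basis _ ℂ (D.ideal × Module.Dual ℂ (Param D.ideal r)))

section
variable (hD : ∀ t, D.main t = none)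

lemma heisenbergBasis_h_fst (l : Fin r) : (heisenbergBasis c hD (Sum.inl l)).1 = 0 := by
  change ((((monoBasis hD).prod ((monoBasis hD).prod (Pi.basisFun ℂ (Fin r))).dualBasis).reindex
    (heisenbergEquiv D r)) (Sum.inl l)).1 = 0
  rw [Module.Basis.reindex_apply, show (heisenbergEquiv D r).symm (Sum.inl l) =
    Sum.inr (Sum.inr l) from rfl]
  simp

lemma heisenbergBasis_h_snd (l : Fin r) (ξ : Param D.ideal r) :
    (heisenbergBasis c hD (Sum.inl l)).2 ξ = ξ.2 l := by
  change ((((monoBasis hD).prod ((monoBasis hD).prod (Pi.basisFun ℂ (Fin r))).dualBasis).reindex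
    (heisenbergEquiv D r)) (Sum.inl l)).2 ξ = _
  rw [Module.Basis.reindex_apply, show (heisenbergEquiv D r).symm (Sum.inl l) =
    Sum.inr (Sum.inr l) from rfl, Module.Basis.prod_apply_inr_snd, Module.Basis.dualBasis_apply]
  simp

lemma heisenbergBasis_e_fst (t : Fin D.p) (i : Fin (D.s t)) (j : Fin (D.n t i)) :
    (heisenbergBasis c hD (Sum.inr (Sum.inl ⟨t, i, j⟩))).1 = 0 := by
  change ((((monoBasis hD).prod ((monoBasis hD).prod (Pi.basisFun ℂ (Fin r))).dualBasis).reindex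
    (heisenbergEquiv D r)) (Sum.inr (Sum.inl ⟨t, i, j⟩))).1 = 0
  rw [Module.Basis.reindex_apply, show (heisenbergEquiv D r).symm (Sum.inr (Sum.inl ⟨t, i, j⟩)) =
    Sum.inr (Sum.inl ⟨⟨t, i⟩, j⟩) from rfl]
  simp

lemma heisenbergBasis_e_snd (t : Fin D.p) (i : Fin (D.s t)) (j : Fin (D.n t i))
    (ξ : Param D.ideal r) : (heisenbergBasis c hD (Sum.inr (Sum.inl ⟨t, i, j⟩))).2 ξ =
      Trunc.coeff _ (j.val + 1) (D.comp ⟨t, i⟩ ξ.1) := by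
  change ((((monoBasis hD).prod ((monoBasis hD).prod (Pi.basisFun ℂ (Fin r))).dualBasis).reindex
    (heisenbergEquiv D r)) (Sum.inr (Sum.inl ⟨t, i, j⟩))).2 ξ = _
  rw [Module.Basis.reindex_apply, show (heisenbergEquiv D r).symm (Sum.inr (Sum.inl ⟨t, i, j⟩)) =
    Sum.inr (Sum.inl ⟨⟨t, i⟩, j⟩) from rfl, Module.Basis.prod_apply_inr_snd,
    Module.Basis.dualBasis_apply, Module.Basis.prod_repr_inl, monoBasis_repr]

lemma heisenbergBasis_f_fst (t : Fin D.p) (i : Fin (D.s t)) (j : Fin (D.n t i)) :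
    (heisenbergBasis c hD (Sum.inr (Sum.inr ⟨t, i, j⟩))).1 = D.mono ⟨t, i⟩ j := by
  change ((((monoBasis hD).prod ((monoBasis hD).prod (Pi.basisFun ℂ (Fin r))).dualBasis).reindex
    (heisenbergEquiv D r)) (Sum.inr (Sum.inr ⟨t, i, j⟩))).1 = _
  rw [Module.Basis.reindex_apply, show (heisenbergEquiv D r).symm (Sum.inr (Sum.inr ⟨t, i, j⟩)) =
    Sum.inl ⟨⟨t, i⟩, j⟩ from rfl, Module.Basis.prod_apply_inl_fst, monoBasis_apply]

lemma heisenbergBasis_f_snd (t : Fin D.p) (i : Fin (D.s t)) (j : Fin (D.n t i)) :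
    (heisenbergBasis c hD (Sum.inr (Sum.inr ⟨t, i, j⟩))).2 = 0 := by
  change ((((monoBasis hD).prod ((monoBasis hD).prod (Pi.basisFun ℂ (Fin r))).dualBasis).reindex
    (heisenbergEquiv D r)) (Sum.inr (Sum.inr ⟨t, i, j⟩))).2 = 0
  rw [Module.Basis.reindex_apply, show (heisenbergEquiv D r).symm (Sum.inr (Sum.inr ⟨t, i, j⟩)) =
    Sum.inl ⟨⟨t, i⟩, j⟩ from rfl]
  simp

/-- `e` reads off the coefficient of `y ^ (j + 1)` and `f` multiplies by `y ^ (k + 1)`, so within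
one block the bracket reads off the coefficient of `y ^ (j - k)` of the parameter. -/
lemma lie_heisenberg_e_f_snd (t : Fin D.p) (i : Fin (D.s t)) (j : Fin (D.n t i))
    (t' : Fin D.p) (i' : Fin (D.s t')) (k : Fin (D.n t' i')) (ξ : Param D.ideal r) :
    (⁅heisenbergBasis c hD (Sum.inr (Sum.inl ⟨t, i, j⟩)),
      heisenbergBasis c hD (Sum.inr (Sum.inr ⟨t', i', k⟩))⁆ :
        SemidirectAlg D.ideal (D.scalars c)).2 ξ =
      Trunc.coeff _ (j.val + 1) (D.comp ⟨t, i⟩ (paramElt D.ideal (D.scalars c) ξ) *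
        D.comp ⟨t, i⟩ (D.mono ⟨t', i'⟩ k)) := by
  rw [SemidirectAlg.lie_snd, heisenbergBasis_f_snd, heisenbergBasis_f_fst, LinearMap.zero_apply,
    sub_zero, heisenbergBasis_e_snd, paramAct_apply, ← map_mul]
  rfl

lemma lie_heisenberg_e_f_same (t : Fin D.p) (i : Fin (D.s t)) (j k : Fin (D.n t i))
    (ξ : Param D.ideal r) :
    (⁅heisenbergBasis c hD (Sum.inr (Sum.inl ⟨t, i, j⟩)),
      heisenbergBasis c hD (Sum.inr (Sum.inr ⟨t, i, k⟩))⁆ :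
        SemidirectAlg D.ideal (D.scalars c)).2 ξ =
      if k ≤ j then Trunc.coeff _ (j.val - k.val)
        (D.comp ⟨t, i⟩ (paramElt D.ideal (D.scalars c) ξ)) else 0 := by
  have hj : j.val + 1 < D.order ⟨t, i⟩ := by
    rw [order_eq_of_none hD]
    exact Nat.succ_lt_succ j.isLt
  rw [lie_heisenberg_e_f_snd, comp_mono_self, Trunc.coeff_mul_X_pow hj, Nat.add_sub_add_right]
  simp only [Nat.add_le_add_iff_right, Fin.le_def]

lemma coeff_comp_paramElt (ξ : Param D.ideal r) (κ : D.Idx) {k : ℕ} (hk : k < D.order κ)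
    (h0 : k ≠ 0) : Trunc.coeff _ k (D.comp κ (paramElt D.ideal (D.scalars c) ξ)) =
      Trunc.coeff _ k (D.comp κ ξ.1) := by
  rw [paramElt_apply]
  simp [comp_scalars, Trunc.coeff_algebraMap hk h0]

/-- For `k < j` the coefficient of `y ^ (j - k)` is the coordinate `e` with zero-based index `j - k
- 1`. For `j = k` it is the constant term, which comes only from the scalars and yields `∑ l, c t l
• h l`. -/
theorem isHeisenbergType (hD : ∀ t, D.main t = none) :
    IsHeisenbergType (SemidirectAlg D.ideal (D.scalars c)) D.n c := by
  refine ⟨heisenbergBasis c hD, ?_, ?_, ?_, ?_, ?_, ?_, ?_⟩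
  · intro l v
    refine SemidirectAlg.ext' rfl fun ξ => ?_
    rw [SemidirectAlg.lie_snd, heisenbergBasis_h_snd, heisenbergBasis_h_fst, map_zero,
      LinearMap.zero_apply, map_zero, sub_zero]
    rfl
  · intro t i j t' i' k
    refine SemidirectAlg.ext' rfl fun ξ => ?_
    rw [SemidirectAlg.lie_snd, heisenbergBasis_e_fst, heisenbergBasis_e_fst, map_zero,
      LinearMap.zero_apply, map_zero, map_zero, sub_zero]
    rfl
  · intro t i j t' i' k
    refine SemidirectAlg.ext' rfl fun ξ => ?_
    rw [SemidirectAlg.lie_snd, heisenbergBasis_f_snd, heisenbergBasis_f_snd, LinearMap.zero_apply,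
      LinearMap.zero_apply, sub_zero]
    rfl
  · intro t i j t' i' k hne
    refine SemidirectAlg.ext' rfl fun ξ => ?_
    rw [lie_heisenberg_e_f_snd, comp_mono_of_ne D hne, mul_zero, map_zero]
    rfl
  · intro t i j k hkj
    refine SemidirectAlg.ext' (heisenbergBasis_e_fst c hD t i _).symm fun ξ => ?_
    have hkj' : k.val < j.val := hkj
    have hj : j.val - k.val < D.order ⟨t, i⟩ := by
      rw [order_eq_of_none hD]
      exact lt_of_le_of_lt (Nat.sub_le _ _) (Nat.lt_succ_of_lt j.isLt)
    rw [lie_heisenberg_e_f_same, if_pos hkj.le, heisenbergBasis_e_snd,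
      coeff_comp_paramElt c ξ _ hj (by omega)]
    congr 2
    simp only
    omega
  · intro t i j
    have hsum1 : (∑ l, c t l • heisenbergBasis c hD (Sum.inl l) :
        SemidirectAlg D.ideal (D.scalars c)).1 = 0 :=
      Prod.fst_sum.trans (Finset.sum_eq_zero fun l _ => by
        rw [SemidirectAlg.smul_fst, heisenbergBasis_h_fst, smul_zero])
    have hsum2 : (∑ l, c t l • heisenbergBasis c hD (Sum.inl l) :
        SemidirectAlg D.ideal (D.scalars c)).2 =
        ∑ l, c t l • (heisenbergBasis c hD (Sum.inl l)).2 := Prod.snd_sum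
    refine SemidirectAlg.ext' hsum1.symm fun ξ => ?_
    rw [hsum2, lie_heisenberg_e_f_same, if_pos le_rfl, Nat.sub_self, coeff_zero_comp,
      paramElt_apply, map_add, ξ.1.2 t (hD t), zero_add, map_sum, LinearMap.sum_apply]
    refine Finset.sum_congr rfl fun l _ => ?_
    rw [map_smul, LinearMap.smul_apply, heisenbergBasis_h_snd, ← coeff_zero_comp D ⟨t, i⟩,
      comp_scalars, Trunc.coeff_zero_algebraMap (D.order_pos _), smul_eq_mul, smul_eq_mul, mul_comm]
  · intro t i j k hjk
    refine SemidirectAlg.ext' rfl fun ξ => ?_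
    rw [lie_heisenberg_e_f_same, if_neg (not_le.mpr hjk)]
    rfl

end

end TupleData

lemma exists_unique_max {s : ℕ} (hs : 0 < s) (n : Fin s → ℕ) (h : ¬ HasMultipleMaxima n) :
    ∃ i, ∀ j, j ≠ i → n j < n i := by
  have : Nonempty (Fin s) := ⟨⟨0, hs⟩⟩
  obtain ⟨i, hi⟩ := Finite.exists_max n
  exact ⟨i, fun j hj => lt_of_le_of_ne (hi j) fun he => h ⟨i, j, hj.symm, he.symm, hi⟩⟩

end JordanKronecker

end

/-! ### The two realization statements -/

theorem mainTheorem7 :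
    (∀ (p : ℕ) (s : Fin p → ℕ) (n : (t : Fin p) → Fin (s t) → ℕ),
      (∀ t, 0 < s t) → (∀ t i, 0 < n t i) →
      (∀ t t', JordanKronecker.HasMultipleMaxima (n t) →
        JordanKronecker.HasMultipleMaxima (n t') → t = t') →
      ∃ (𝔤 : Type) (_ : LieRing 𝔤) (_ : LieAlgebra ℂ 𝔤), FiniteDimensional ℂ 𝔤 ∧
        JordanKronecker.HasJKInvariants 𝔤 (JordanKronecker.trivialKroneckerType n 1)) ∧
    (∀ (p : ℕ) (s : Fin p → ℕ) (n : (t : Fin p) → Fin (s t) → ℕ) (r : ℕ),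
      (∀ t, 0 < s t) → (∀ t i, 0 < n t i) → 2 ≤ r →
      ∃ (𝔤 : Type) (_ : LieRing 𝔤) (_ : LieAlgebra ℂ 𝔤), FiniteDimensional ℂ 𝔤 ∧
        JordanKronecker.HasJKInvariants 𝔤 (JordanKronecker.trivialKroneckerType n r) ∧
        JordanKronecker.IsHeisenbergType 𝔤 n (fun (t : Fin p) (l : Fin r) =>
          if l.val = 0 then (1 : ℂ) else if l.val = 1 then (t.val : ℂ) + 1 else 0)) := by
  classical
  constructor
  · intro p s n hs hn hmult
    -- The unique maximum is distinguished wherever there is one; by assumption at most one tuple is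
    -- left without.
    have hex : ∀ t, ∃ m : Option (Fin (s t)),
        (m = none → JordanKronecker.HasMultipleMaxima (n t)) ∧
        ∀ i j, m = some i → j ≠ i → n t j < n t i := by
      intro t
      by_cases h : JordanKronecker.HasMultipleMaxima (n t)
      · exact ⟨none, fun _ => h, fun i j h => by cases h⟩
      · obtain ⟨i, hi⟩ := JordanKronecker.exists_unique_max (hs t) (n t) h
        exact ⟨some i, fun h => absurd h (Option.some_ne_none i), fun i' j h hj => by
          obtain rfl := Option.some.inj h
          exact hi j hj⟩
    choose m hm hlt using hex
    let D : JordanKronecker.TupleData := ⟨p, s, n, m, hs, hn, hlt⟩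
    exact ⟨JordanKronecker.SemidirectAlg D.ideal
      (D.scalars fun t (_ : Fin 1) => if D.main t = none then 1 else 0), inferInstance,
      inferInstance, inferInstance, D.hasJKInvariants _
        (D.exists_isGeneric_of_unique fun t t' h h' => hmult t t' (hm t h) (hm t' h'))⟩
  · intro p s n r hs hn hr
    let D : JordanKronecker.TupleData := ⟨p, s, n, fun _ => none, hs, hn, fun t i j h => by cases h⟩
    let c : Fin p → Fin r → ℂ := fun t l =>
      if l.val = 0 then (1 : ℂ) else if l.val = 1 then (t.val : ℂ) + 1 else 0
    refine ⟨JordanKronecker.SemidirectAlg D.ideal (D.scalars c), inferInstance, inferInstance,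
      inferInstance, D.hasJKInvariants c ?_,
      JordanKronecker.TupleData.isHeisenbergType (D := D) c fun _ => rfl⟩
    have hsum : ∀ (l₀ : Fin r) (t : Fin p),
        (0 : ℂ) + ∑ l, c t l * (Pi.single l₀ 1 : Fin r → ℂ) l = c t l₀ := by
      intro l₀ t
      simp [Pi.single_apply]
    -- `α` is dual to the first central element, whose scalars are all `1`; `ξ` is `y` plus the dual
    -- of the second, giving the distinct eigenvalues `t + 1`.
    refine ⟨(⟨D.affine (fun _ => 0) 1, D.affine_mem_ideal (fun _ _ => rfl) 1⟩,
      Pi.single ⟨1, by omega⟩ 1), (⟨D.affine (fun _ => 0) 0, D.affine_mem_ideal (fun _ _ => rfl) 0⟩,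
      Pi.single ⟨0, by omega⟩ 1), D.isGeneric_of_affine c (v := fun t => (t.val : ℂ) + 1) ?_ ?_ ?_⟩
    · exact fun t t' h => Fin.ext (Nat.cast_injective (R := ℂ) (add_right_cancel h))
    · rw [JordanKronecker.TupleData.paramElt_affine]
      congr 1
      funext t
      exact (hsum _ t).trans (by simp [c])
    · rw [JordanKronecker.TupleData.paramElt_affine]
      congr 1
      funext t
      exact (hsum _ t).trans (by simp [c])
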